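/- Let $n\ge 1$ and $1\le q\le\infty$. All functions and distributions live on $\mathbb{R}^n$ and are complex-valued. Let $\mathcal{D}$ be the space of test functions, $\mathcal{S}$ the space of rapidly decreasing functions and $\mathcal{E}=\mathcal{C}^\infty(\mathbb{R}^n)$, with their usual topologies; for $1\le p\le\infty$ let $\mathcal{D}_{L^p}=\{f\in\mathcal{C}^\infty : \partial^\alpha f\in L^p\ \forall\alpha\}$, with the norms $\sup_{|\alpha|\le m}\|\partial^\alpha f\|_{p}$, and let $\dot{\mathcal{B}}\subset\mathcal{D}_{L^\infty}$ be the subspace of functions all of whose derivatives tend to $0$ at infinity, with the induced topology; let $\mathcal{O}_M=\{f\in\mathcal{C}^\infty : \forall\alpha\ \exists k\colon (1+|x|^2)^{-k}\partial^\alpha f(x)\to 0 \text{ as } |x|\to\infty\}$, with the seminorms $\sup_{|\alpha|\le m}\|\psi\,\partial^\alpha f\|_\infty$ for $\psi\in\mathcal{S}$, $m\in\mathbb{N}_0$, and $\mathcal{O}_C=\{f\in\mathcal{C}^\infty : \exists k\ \forall\alpha\colon (1+|x|^2)^{-k}\partial^\alpha f(x)\to 0 \text{ as } |x|\to\infty\}$,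 with the locally convex inductive limit topology over $k$. The spaces $\mathcal{D}',\mathcal{S}',\mathcal{E}',\mathcal{O}_M',\mathcal{O}_C'$ are the strong duals (topology of uniform convergence on bounded sets) of the corresponding function spaces; $\mathcal{D}'_{L^q}$ is the strong dual of $\mathcal{D}_{L^p}$, $\frac1p+\frac1q=1$, if $q>1$, and of $\dot{\mathcal{B}}$ if $q=1$. The product of a distribution $T$ and a smooth function $f$ is defined by $\langle\varphi,fT\rangle=\langle f\varphi,T\rangle$, and the convolution of $S\in\mathcal{S}'$ and $T\in\mathcal{O}_C'$ by $\langle\varphi,S*T\rangle=\langle \psi,S\rangle$ with $\psi(x)=\langle\varphi(x+\cdot),T\rangle$ for $\varphi\in\mathcal{S}$. Then the multiplications $\mathcal{E}'\times\mathcal{E}\to\mathcal{E}'$, $\mathcal{O}_M'\times\mathcal{O}_M\to\mathcal{O}_M'$, $\mathcal{O}_C'\times\mathcal{O}_C\to\mathcal{O}_C'$, $\mathcal{D}'_{L^q}\times\mathcal{D}_{L^\infty}\to\mathcal{D}'_{L^q}$, $\mathcal{S}'\times\mathcal{O}_M\to\mathcal{S}'$ and $\mathcal{D}'\times\mathcal{E}\to\mathcal{D}'$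 and the convolution $\mathcal{S}'\times\mathcal{O}_C'\to\mathcal{S}'$ are well defined, and each of them is discontinuous as a map on the product space. The multiplication $\mathcal{E}'\times\mathcal{D}_{L^\infty}\to\mathcal{D}'$ is discontinuous as well. -/

import Mathlib

open MeasureTheory Filter Topology
open scoped ENNReal ContDiff SchwartzMap Distributions

noncomputable section

/-- The space `ℝⁿ` with its Euclidean norm. -/
abbrev Rn (n : ℕ) : Type := EuclideanSpace ℝ (Fin n)

/-! ## Spaces of functions on `ℝⁿ`

All functions are complex-valued. The partial derivatives `∂^α f` of order `|α| = m` are encoded by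
the `m`-th derivative `iteratedFDeriv ℝ m f`, whose norm at a point is equivalent to the maximum of
the `|∂^α f|`, `|α| = m`, at that point. -/

/-- A linear space of functions, without the topology of pointwise convergence which a subspace of
`ℝⁿ → ℂ` would inherit. -/
def FnSpace {n : ℕ} (P : Submodule ℂ (Rn n → ℂ)) : Type := ↥P

instance {n : ℕ} (P : Submodule ℂ (Rn n → ℂ)) : AddCommGroup (FnSpace P) :=
  inferInstanceAs (AddCommGroup ↥P)

instance {n : ℕ} (P : Submodule ℂ (Rn n → ℂ)) : Module ℂ (FnSpace P) :=
  inferInstanceAs (Module ℂ ↥P)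

instance {n : ℕ} (P : Submodule ℂ (Rn n → ℂ)) : FunLike (FnSpace P) (Rn n) ℂ where
  coe f := f.1
  coe_injective := Subtype.val_injective

theorem FnSpace.mem {n : ℕ} {P : Submodule ℂ (Rn n → ℂ)} (f : FnSpace P) : ⇑f ∈ P := f.2

theorem FnSpace.coe_add {n : ℕ} {P : Submodule ℂ (Rn n → ℂ)} (f g : FnSpace P) :
    ⇑(f + g) = ⇑f + ⇑g := rfl

theorem FnSpace.coe_smul {n : ℕ} {P : Submodule ℂ (Rn n → ℂ)} (c : ℂ) (f : FnSpace P) :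
    ⇑(c • f) = c • ⇑f := rfl

theorem iteratedFDeriv_add_of_smooth {n : ℕ} {f g : Rn n → ℂ} (hf : ContDiff ℝ ∞ f)
    (hg : ContDiff ℝ ∞ g) (m : ℕ) :
    iteratedFDeriv ℝ m (f + g) = iteratedFDeriv ℝ m f + iteratedFDeriv ℝ m g :=
  iteratedFDeriv_add (hf.of_le (mod_cast le_top)) (hg.of_le (mod_cast le_top))

theorem iteratedFDeriv_smul_of_smooth {n : ℕ} {f : Rn n → ℂ} (hf : ContDiff ℝ ∞ f) (c : ℂ)
    (m : ℕ) : iteratedFDeriv ℝ m (c • f) = c • iteratedFDeriv ℝ m f := by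
  ext1 x
  exact iteratedFDeriv_const_smul_apply (hf.of_le (mod_cast le_top)).contDiffAt

theorem continuous_iteratedFDeriv_of_smooth {n : ℕ} {f : Rn n → ℂ} (hf : ContDiff ℝ ∞ f) (m : ℕ) :
    Continuous (iteratedFDeriv ℝ m f) :=
  hf.continuous_iteratedFDeriv (mod_cast le_top)

/-- The seminorm `f ↦ sup_{x ∈ A} |w x| ‖D^m f(x)‖`, on a space of smooth functions on which it is
finite. -/
def supSeminorm {n : ℕ} {P : Submodule ℂ (Rn n → ℂ)} (hP : ∀ f ∈ P, ContDiff ℝ ∞ f)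
    (A : Set (Rn n)) (w : Rn n → ℝ) (m : ℕ)
    (hb : ∀ f ∈ P, BddAbove (Set.range fun x : A ↦ |w x| * ‖iteratedFDeriv ℝ m f x‖)) :
    Seminorm ℂ (FnSpace P) :=
  Seminorm.of (fun f ↦ ⨆ x : A, |w x| * ‖iteratedFDeriv ℝ m f x‖)
    (fun f g ↦ by
      have h0 : ∀ h : FnSpace P, 0 ≤ ⨆ x : A, |w x| * ‖iteratedFDeriv ℝ m h x‖ :=
        fun h ↦ Real.iSup_nonneg fun x ↦ by positivity
      refine Real.iSup_le (fun x ↦ ?_) (add_nonneg (h0 f) (h0 g))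
      rw [FnSpace.coe_add, iteratedFDeriv_add_of_smooth (hP _ f.mem) (hP _ g.mem), Pi.add_apply]
      calc |w x| * ‖iteratedFDeriv ℝ m f x + iteratedFDeriv ℝ m g x‖
          ≤ |w x| * ‖iteratedFDeriv ℝ m f x‖ + |w x| * ‖iteratedFDeriv ℝ m g x‖ := by
            rw [← mul_add]; gcongr; exact norm_add_le _ _
        _ ≤ _ := add_le_add (le_ciSup (hb _ f.mem) x) (le_ciSup (hb _ g.mem) x))
    (fun c f ↦ by
      rw [FnSpace.coe_smul, iteratedFDeriv_smul_of_smooth (hP _ f.mem),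
        Real.mul_iSup_of_nonneg (norm_nonneg c)]
      congr 1
      ext1 x
      rw [Pi.smul_apply, norm_smul]
      ring)

/-! ### The space `𝓔` of all smooth functions -/

def smoothSub (n : ℕ) : Submodule ℂ (Rn n → ℂ) where
  carrier := {f | ContDiff ℝ ∞ f}
  add_mem' {f g} (hf : ContDiff ℝ ∞ f) (hg : ContDiff ℝ ∞ g) := hf.add hg
  zero_mem' := (contDiff_zero_fun : ContDiff ℝ ∞ fun _ : Rn n ↦ (0 : ℂ))
  smul_mem' c f (hf : ContDiff ℝ ∞ f) := hf.const_smul c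

/-- `𝓔`, the smooth functions on `ℝⁿ`. -/
abbrev SpaceE (n : ℕ) : Type := FnSpace (smoothSub n)

/-- The seminorms `sup_{x ∈ K} ‖D^m f(x)‖`, where `K` is compact. -/
def seminormsE (n : ℕ) :
    SeminormFamily ℂ (SpaceE n) (TopologicalSpace.Compacts (Rn n) × ℕ) := fun i ↦
  supSeminorm (fun _ hf ↦ hf) (i.1 : Set (Rn n)) (fun _ ↦ 1) i.2 fun f hf ↦ by
    have hc : Continuous fun x ↦ |(1 : ℝ)| * ‖iteratedFDeriv ℝ i.2 f x‖ :=
      continuous_const.mul (continuous_iteratedFDeriv_of_smooth hf _).norm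
    have := (i.1.isCompact.image hc).bddAbove
    rwa [Set.image_eq_range] at this

instance (n : ℕ) : TopologicalSpace (SpaceE n) := (seminormsE n).moduleFilterBasis.topology

/-! ### The space `𝓞_M` of slowly increasing functions -/

def temperateSub (n : ℕ) : Submodule ℂ (Rn n → ℂ) where
  carrier := {f | f.HasTemperateGrowth}
  add_mem' hf hg := hf.add hg
  zero_mem' := .zero
  smul_mem' c _ hf := (Function.HasTemperateGrowth.const c).mul hf

/-- `𝓞_M`, the smooth functions all of whose derivatives are polynomially bounded. -/
abbrev SpaceOM (n : ℕ) : Type := FnSpace (temperateSub n)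

/-- The seminorms `sup_x |ψ(x)| ‖D^m f(x)‖`, where `ψ` is rapidly decreasing. -/
def seminormsOM (n : ℕ) : SeminormFamily ℂ (SpaceOM n) (𝓢(Rn n, ℂ) × ℕ) := fun i ↦
  supSeminorm (fun _ hf ↦ hf.1) Set.univ (fun x ↦ ‖i.1 x‖) i.2 fun f hf ↦ by
    obtain ⟨k, C, hC⟩ := hf.2 i.2
    obtain ⟨D, hD⟩ : ∃ D : ℝ, ∀ x, (1 + ‖x‖) ^ k * ‖i.1 x‖ ≤ D :=
      ⟨_, fun x ↦ by
        simpa using SchwartzMap.one_add_le_sup_seminorm_apply (𝕜 := ℝ) (m := (k, 0)) le_rfl le_rfl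
          i.1 x⟩
    have hC0 : 0 ≤ C := by
      have := (norm_nonneg _).trans (hC 0)
      simpa using this
    refine ⟨C * D, ?_⟩
    rintro _ ⟨x, rfl⟩
    calc |‖i.1 x‖| * ‖iteratedFDeriv ℝ i.2 f x‖
        ≤ ‖i.1 x‖ * (C * (1 + ‖(x : Rn n)‖) ^ k) := by
          rw [abs_norm]; exact mul_le_mul_of_nonneg_left (hC x) (norm_nonneg _)
      _ = C * ((1 + ‖(x : Rn n)‖) ^ k * ‖i.1 x‖) := by ring
      _ ≤ C * D := mul_le_mul_of_nonneg_left (hD x) hC0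

instance (n : ℕ) : TopologicalSpace (SpaceOM n) := (seminormsOM n).moduleFilterBasis.topology

/-! ### The space `𝓞_C` of very slowly increasing functions -/

/-- Smooth functions `f` such that `(1 + |x|²)^{-k} D^m f(x) → 0` as `|x| → ∞`, for every `m`. -/
def stepSub (n k : ℕ) : Submodule ℂ (Rn n → ℂ) where
  carrier := {f | ContDiff ℝ ∞ f ∧ ∀ m : ℕ, Tendsto
    (fun x ↦ ((1 + ‖x‖ ^ 2) ^ k)⁻¹ • iteratedFDeriv ℝ m f x) (cocompact (Rn n)) (𝓝 0)}
  add_mem' {f g} hf hg := by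
    refine ⟨hf.1.add hg.1, fun m ↦ ?_⟩
    rw [iteratedFDeriv_add_of_smooth hf.1 hg.1]
    simpa only [Pi.add_apply, smul_add, add_zero] using (hf.2 m).add (hg.2 m)
  zero_mem' := ⟨contDiff_zero_fun, fun m ↦ by
    have h : iteratedFDeriv ℝ m (0 : Rn n → ℂ) = 0 := iteratedFDeriv_fun_zero
    simp only [h, Pi.zero_apply, smul_zero, tendsto_const_nhds]⟩
  smul_mem' c f hf := by
    refine ⟨hf.1.const_smul c, fun m ↦ ?_⟩
    rw [iteratedFDeriv_smul_of_smooth hf.1]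
    have h := (hf.2 m).const_smul c
    rw [smul_zero] at h
    exact h.congr fun x ↦ smul_comm _ _ _

/-- The seminorms `sup_x (1 + |x|²)^{-k} ‖D^m f(x)‖`. -/
def seminormsStep (n k : ℕ) : SeminormFamily ℂ (FnSpace (stepSub n k)) ℕ := fun m ↦
  supSeminorm (fun _ hf ↦ hf.1) Set.univ (fun x ↦ ((1 + ‖x‖ ^ 2) ^ k)⁻¹) m fun f hf ↦ by
    have hc : Continuous fun x : Rn n ↦ ((1 + ‖x‖ ^ 2) ^ k)⁻¹ • iteratedFDeriv ℝ m f x := by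
      have h1 : Continuous fun x : Rn n ↦ (1 + ‖x‖ ^ 2) ^ k := by fun_prop
      exact (h1.inv₀ fun x ↦ by positivity).smul (continuous_iteratedFDeriv_of_smooth hf.1 m)
    obtain ⟨C, hC⟩ := (ZeroAtInftyContinuousMap.mk ⟨_, hc⟩ (hf.2 m)).toBCF.bddAbove_range_norm_comp
    refine ⟨C, ?_⟩
    rintro _ ⟨x, rfl⟩
    have := hC ⟨(x : Rn n), rfl⟩
    simpa [norm_smul] using this

instance (n k : ℕ) : TopologicalSpace (FnSpace (stepSub n k)) :=
  (seminormsStep n k).moduleFilterBasis.topology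

theorem stepSub_mono (n : ℕ) {k l : ℕ} (h : k ≤ l) : stepSub n k ≤ stepSub n l := by
  refine fun f hf ↦ ⟨hf.1, fun m ↦ ?_⟩
  refine squeeze_zero_norm (fun x ↦ ?_) (tendsto_zero_iff_norm_tendsto_zero.1 (hf.2 m))
  rw [norm_smul, norm_smul, norm_inv, norm_inv, norm_pow, norm_pow]
  have h1 : 1 ≤ ‖(1 + ‖x‖ ^ 2 : ℝ)‖ := by
    rw [Real.norm_of_nonneg (by positivity)]
    exact le_add_of_nonneg_right (by positivity)
  gcongr

/-- `𝓞_C = ⋃ₖ stepSub n k`: the exponent `k` does not depend on the order of the derivative. -/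
def slowSub (n : ℕ) : Submodule ℂ (Rn n → ℂ) where
  carrier := {f | ∃ k, f ∈ stepSub n k}
  add_mem' := by
    rintro f g ⟨k, hf⟩ ⟨l, hg⟩
    exact ⟨max k l, add_mem (stepSub_mono n (le_max_left k l) hf)
      (stepSub_mono n (le_max_right k l) hg)⟩
  zero_mem' := ⟨0, zero_mem _⟩
  smul_mem' := by
    rintro c f ⟨k, hf⟩
    exact ⟨k, Submodule.smul_mem _ c hf⟩

/-- `𝓞_C`, the very slowly increasing functions. -/
abbrev SpaceOC (n : ℕ) : Type := FnSpace (slowSub n)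

def stepToOC (n k : ℕ) (f : FnSpace (stepSub n k)) : SpaceOC n := ⟨f, k, f.mem⟩

/-- All seminorms on `𝓞_C` with continuous restriction to every step: they define the locally
convex inductive limit topology, i.e. the finest locally convex topology for which the inclusions of
the steps are continuous. -/
def seminormsOC (n : ℕ) : SeminormFamily ℂ (SpaceOC n)
    {p : Seminorm ℂ (SpaceOC n) // ∀ k, Continuous fun f ↦ p (stepToOC n k f)} := fun p ↦ p.1

instance (n : ℕ) : TopologicalSpace (SpaceOC n) := (seminormsOC n).moduleFilterBasis.topology

/-! ### The spaces `𝓓_{L^p}` and `𝓑̇` -/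

def lpSub (n : ℕ) (p : ℝ≥0∞) : Submodule ℂ (Rn n → ℂ) where
  carrier := {f | ContDiff ℝ ∞ f ∧ ∀ m : ℕ, MemLp (iteratedFDeriv ℝ m f) p volume}
  add_mem' {f g} hf hg := by
    refine ⟨hf.1.add hg.1, fun m ↦ ?_⟩
    rw [iteratedFDeriv_add_of_smooth hf.1 hg.1]
    exact (hf.2 m).add (hg.2 m)
  zero_mem' := ⟨contDiff_zero_fun, fun m ↦ by
    have h : iteratedFDeriv ℝ m (0 : Rn n → ℂ) = 0 := iteratedFDeriv_fun_zero
    rw [h]; exact MemLp.zero⟩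
  smul_mem' c f hf := by
    refine ⟨hf.1.const_smul c, fun m ↦ ?_⟩
    rw [iteratedFDeriv_smul_of_smooth hf.1]
    exact (hf.2 m).const_smul c

/-- The seminorm `f ↦ ‖D^m f‖_{L^p}`, on a space of functions on which it is finite. -/
def lpSeminorm {n : ℕ} {p : ℝ≥0∞} (hp : 1 ≤ p) {P : Submodule ℂ (Rn n → ℂ)} (hP : P ≤ lpSub n p)
    (m : ℕ) : Seminorm ℂ (FnSpace P) :=
  Seminorm.of (fun f ↦ (eLpNorm (iteratedFDeriv ℝ m f) p volume).toReal)
    (fun f g ↦ by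
      have hf := hP f.mem
      have hg := hP g.mem
      rw [FnSpace.coe_add, iteratedFDeriv_add_of_smooth hf.1 hg.1,
        ← ENNReal.toReal_add (hf.2 m).eLpNorm_ne_top (hg.2 m).eLpNorm_ne_top]
      exact ENNReal.toReal_mono
        (ENNReal.add_ne_top.2 ⟨(hf.2 m).eLpNorm_ne_top, (hg.2 m).eLpNorm_ne_top⟩)
        (eLpNorm_add_le (hf.2 m).1 (hg.2 m).1 hp))
    (fun c f ↦ by
      rw [FnSpace.coe_smul, iteratedFDeriv_smul_of_smooth (hP f.mem).1, eLpNorm_const_smul,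
        ENNReal.toReal_mul, toReal_enorm])

/-- `𝓓_{L^p}`, the smooth functions all of whose derivatives belong to `L^p`. -/
abbrev SpaceDL (n : ℕ) (p : ℝ≥0∞) : Type := FnSpace (lpSub n p)

instance (n : ℕ) (p : ℝ≥0∞) [hp : Fact (1 ≤ p)] : TopologicalSpace (SpaceDL n p) :=
  SeminormFamily.moduleFilterBasis (fun m : ℕ ↦ lpSeminorm hp.out (le_refl (lpSub n p)) m)
    |>.topology

/-- For `p < ∞` all of `𝓓_{L^p}`; for `p = ∞` the functions in `𝓓_{L^∞}` all of whose derivatives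
tend to `0` at infinity. -/
def lpDotSub (n : ℕ) (p : ℝ≥0∞) : Submodule ℂ (Rn n → ℂ) where
  carrier := {f | f ∈ lpSub n p ∧
    (p = ⊤ → ∀ m : ℕ, Tendsto (iteratedFDeriv ℝ m f) (cocompact (Rn n)) (𝓝 0))}
  add_mem' {f g} hf hg := by
    refine ⟨add_mem hf.1 hg.1, fun hp m ↦ ?_⟩
    rw [iteratedFDeriv_add_of_smooth hf.1.1 hg.1.1, ← add_zero 0]
    exact (hf.2 hp m).add (hg.2 hp m)
  zero_mem' := ⟨zero_mem _, fun _ m ↦ by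
    have h : iteratedFDeriv ℝ m (0 : Rn n → ℂ) = 0 := iteratedFDeriv_fun_zero
    rw [h]; exact tendsto_const_nhds⟩
  smul_mem' c f hf := by
    refine ⟨Submodule.smul_mem _ c hf.1, fun hp m ↦ ?_⟩
    rw [iteratedFDeriv_smul_of_smooth hf.1.1, ← smul_zero c]
    exact (hf.2 hp m).const_smul c

/-- `𝓓_{L^p}` if `p < ∞`, and `𝓑̇` (with the topology induced by `𝓓_{L^∞}`) if `p = ∞`. -/
abbrev SpaceDLDot (n : ℕ) (p : ℝ≥0∞) : Type := FnSpace (lpDotSub n p)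

instance (n : ℕ) (p : ℝ≥0∞) [hp : Fact (1 ≤ p)] : TopologicalSpace (SpaceDLDot n p) :=
  SeminormFamily.moduleFilterBasis
    (fun m : ℕ ↦ lpSeminorm (P := lpDotSub n p) hp.out (fun _ hf ↦ hf.1) m) |>.topology

instance (q : ℝ≥0∞) : Fact (1 ≤ q.conjExponent) := ⟨le_self_add⟩

/-! ### The space `𝓓` of test functions (with its usual inductive limit topology) -/

abbrev SpaceD (n : ℕ) : Type := 𝓓((⊤ : TopologicalSpace.Opens (Rn n)), ℂ)

/-! ## Spaces of distributions

They are the duals of the spaces above, with the topology of uniform convergence on the bounded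
subsets of the predual; this is the topology of `StrongDual`. -/

/-- `𝓔'`, the distributions with compact support. -/
abbrev DualE (n : ℕ) : Type := StrongDual ℂ (SpaceE n)

/-- `𝓞_M'`, the very rapidly decreasing distributions. -/
abbrev DualOM (n : ℕ) : Type := StrongDual ℂ (SpaceOM n)

/-- `𝓞_C'`, the rapidly decreasing distributions. -/
abbrev DualOC (n : ℕ) : Type := StrongDual ℂ (SpaceOC n)

/-- `𝓓'_{L^q}`: the dual of `𝓓_{L^p}`, `1/p + 1/q = 1`, if `q > 1`, and the dual of `𝓑̇` if
`q = 1`. -/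
abbrev DualDL (n : ℕ) (q : ℝ≥0∞) : Type := StrongDual ℂ (SpaceDLDot n q.conjExponent)

/-- `𝓢'`, the tempered distributions. -/
abbrev DualS (n : ℕ) : Type := StrongDual ℂ 𝓢(Rn n, ℂ)

/-- `𝓓'`, the distributions. -/
abbrev DualD (n : ℕ) : Type := StrongDual ℂ (SpaceD n)

/-! ## Multiplication and convolution -/

/-- `b` is the multiplication `X' × M → Y'`, i.e. `⟨φ, f T⟩ = ⟨f φ, T⟩` for `T ∈ X'`, `f ∈ M` and
`φ ∈ Y`; in particular, `f φ ∈ X`. -/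
def IsMultiplication (n : ℕ) {X M Y : Type} [AddCommGroup X] [Module ℂ X] [TopologicalSpace X]
    [FunLike X (Rn n) ℂ] [FunLike M (Rn n) ℂ] [AddCommGroup Y] [Module ℂ Y] [TopologicalSpace Y]
    [FunLike Y (Rn n) ℂ] (b : StrongDual ℂ X → M → StrongDual ℂ Y) : Prop :=
  ∀ (T : StrongDual ℂ X) (f : M) (φ : Y), ∃ ψ : X, (∀ x, ψ x = f x * φ x) ∧ b T f φ = T ψ

/-- There is at most one multiplication map. -/
theorem IsMultiplication.unique {n : ℕ} {X M Y : Type} [AddCommGroup X] [Module ℂ X]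
    [TopologicalSpace X] [FunLike X (Rn n) ℂ] [FunLike M (Rn n) ℂ] [AddCommGroup Y] [Module ℂ Y]
    [TopologicalSpace Y] [FunLike Y (Rn n) ℂ] {b c : StrongDual ℂ X → M → StrongDual ℂ Y}
    (hb : IsMultiplication n b) (hc : IsMultiplication n c) : b = c := by
  ext T f φ
  obtain ⟨ψ, h1, h2⟩ := hb T f φ
  obtain ⟨χ, h3, h4⟩ := hc T f φ
  have : ψ = χ := DFunLike.ext _ _ fun x ↦ (h1 x).trans (h3 x).symm
  rw [h2, h4, this]

/-- The translate `y ↦ φ(x + y)` of a rapidly decreasing function, as an element of `𝓞_C`. -/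
def translateOC {n : ℕ} (φ : 𝓢(Rn n, ℂ)) (x : Rn n) : SpaceOC n :=
  ⟨fun y ↦ φ (x + y), 0, by
    refine ⟨(φ.smooth ⊤).comp (contDiff_const.add contDiff_id), fun m ↦ ?_⟩
    have h0 : Tendsto (iteratedFDeriv ℝ m φ) (cocompact (Rn n)) (𝓝 0) := by
      obtain ⟨C, -, hC⟩ := φ.decay 1 m
      have h1 : Tendsto (fun y : Rn n ↦ C * ‖y‖⁻¹) (cocompact (Rn n)) (𝓝 (C * 0)) :=
        (tendsto_norm_cocompact_atTop.inv_tendsto_atTop).const_mul C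
      rw [mul_zero] at h1
      refine squeeze_zero_norm' ?_ h1
      filter_upwards [tendsto_norm_cocompact_atTop.eventually_gt_atTop 0] with y hy
      rw [← div_eq_mul_inv, le_div_iff₀ hy, mul_comm]
      simpa using hC y
    have h2 := h0.comp (Homeomorph.addLeft x).isClosedEmbedding.tendsto_cocompact
    refine h2.congr fun y ↦ ?_
    simp [iteratedFDeriv_comp_add_left]⟩

/-- `c` is the convolution `𝓢' × 𝓞_C' → 𝓢'`, i.e. `⟨φ, S ∗ T⟩ = ⟨ψ, S⟩` for `S ∈ 𝓢'`, `T ∈ 𝓞_C'` and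
`φ ∈ 𝓢`, where `ψ(x) = ⟨φ(x + y), T_y⟩`; in particular, `ψ ∈ 𝓢`. -/
def IsConvolution (n : ℕ) (c : DualS n → DualOC n → DualS n) : Prop :=
  ∀ (S : DualS n) (T : DualOC n) (φ : 𝓢(Rn n, ℂ)),
    ∃ ψ : 𝓢(Rn n, ℂ), (∀ x, ψ x = T (translateOC φ x)) ∧ c S T φ = S ψ

/-- There is at most one convolution map. -/
theorem IsConvolution.unique {n : ℕ} {b c : DualS n → DualOC n → DualS n}
    (hb : IsConvolution n b) (hc : IsConvolution n c) : b = c := by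
  ext S T φ
  obtain ⟨ψ, h1, h2⟩ := hb S T φ
  obtain ⟨χ, h3, h4⟩ := hc S T φ
  have : ψ = χ := DFunLike.ext _ _ fun x ↦ (h1 x).trans (h3 x).symm
  rw [h2, h4, this]

end

open MeasureTheory Filter Topology
open scoped ENNReal ContDiff SchwartzMap Distributions LineDeriv

noncomputable section

/-! Suppose a multiplication `X' × M → Y'` is continuous, and fix a test function φ. Near the origin
the scalar `⟨fφ, T⟩` is bounded by 1 on some `U × V`. Since `U` absorbs every `T`, each `T` is
bounded on the single set `φV` (`exists_nhds_forall_bounded`). A weakly bounded set is bounded, so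
every continuous seminorm of `X` is bounded on `φV` (`Seminorm.exists_bound_of_forall_strongDual`).

This is false for multiplications: `V` restricts only finitely many derivatives of functions in
`𝓓_{L^∞}`, so it contains rescaled plane waves whose next derivative is arbitrarily large everywhere
(`exists_planeWave_mem_nhds`). With φ = 1 on the unit ball this derivative survives in the product,
where `X` sees it (`ControlsDerivatives`). Other spaces `M` reduce to `𝓓_{L^∞}` by continuous
inclusion.

For the convolution, `V` is a neighbourhood of 0 in `𝓞_C'`. Bounded subsets of `𝓞_C` have a common
polynomial bound (`exists_polynomial_bound_of_isVonNBounded`), so `V` contains point masses at every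
x whose size decays only polynomially. The corresponding translates of φ are then unbounded in `𝓢`.

Well-definedness is obtained by transposition: multiplication by f is continuous `Y → X` by the
Leibniz rule, and `φ ↦ (x ↦ ⟨φ(x + y), T_y⟩)` is continuous on `𝓢`, with smoothness from a Taylor
estimate and decay from Peetre's inequality (`convSchwartz`). -/

/-! ### Uniform boundedness and continuity criteria -/

/-- Banach–Steinhaus for the evaluations at `s i` on the dual of the seminormed space `(X, p)`. That
dual is complete even if `X` is not, and the map into the bidual preserves the seminorm. -/
theorem Seminorm.exists_bound_of_forall_functional {X ι : Type*} [AddCommGroup X] [Module ℂ X]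
    (p : Seminorm ℂ X) (s : ι → X)
    (h : ∀ T : X →ₗ[ℂ] ℂ, (∃ C, ∀ x, ‖T x‖ ≤ C * p x) → ∃ M, ∀ i, ‖T (s i)‖ ≤ M) :
    ∃ M, ∀ i, p (s i) ≤ M := by
  let _ : SeminormedAddCommGroup X := p.toSeminormedAddCommGroup
  let _ : NormedSpace ℂ X := { norm_smul_le := fun a b ↦ le_of_eq (map_smul_eq_mul p a b) }
  obtain ⟨M, hM⟩ := banach_steinhaus
    (g := fun i ↦ NormedSpace.inclusionInDoubleDual ℂ X (s i)) fun T ↦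
      h T.toLinearMap ⟨‖T‖, fun x ↦ T.le_opNorm x⟩
  exact ⟨M, fun i ↦ ((NormedSpace.inclusionInDoubleDualLi (E := X) ℂ).norm_map (s i)).symm.trans_le
    (hM i)⟩

/-- A weakly bounded family is bounded for every continuous seminorm. -/
theorem Seminorm.exists_bound_of_forall_strongDual {X ι : Type*} [AddCommGroup X] [Module ℂ X]
    [TopologicalSpace X] [IsTopologicalAddGroup X] (p : Seminorm ℂ X) (hp : Continuous p)
    (s : ι → X) (h : ∀ T : StrongDual ℂ X, ∃ M, ∀ i, ‖T (s i)‖ ≤ M) :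
    ∃ M, ∀ i, p (s i) ≤ M := by
  refine p.exists_bound_of_forall_functional s ?_
  rintro T ⟨C, hC⟩
  have hT : Continuous T := by
    refine continuous_of_continuousAt_zero T ?_
    have h1 : Tendsto (fun x ↦ C * p x) (𝓝 0) (𝓝 (C * p 0)) := (hp.tendsto 0).const_mul C
    rw [map_zero, mul_zero] at h1
    simpa only [ContinuousAt, map_zero] using squeeze_zero_norm hC h1
  exact h ⟨T, hT⟩

/-- The bound `r` need not be a seminorm, so explicit sums and composites can serve. -/
theorem continuous_of_seminorm_le {X Y ι : Type*} [AddCommGroup X] [Module ℂ X]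
    [TopologicalSpace X] [AddCommGroup Y] [Module ℂ Y] [TopologicalSpace Y]
    [IsTopologicalAddGroup Y] {q : SeminormFamily ℂ X ι} (hq : WithSeminorms q) (L : Y →ₗ[ℂ] X)
    (h : ∀ i, ∃ r : Y → ℝ, Continuous r ∧ r 0 = 0 ∧ ∀ y, q i (L y) ≤ r y) : Continuous L := by
  have := hq.topologicalAddGroup
  refine continuous_of_continuousAt_zero L ?_
  rw [ContinuousAt, map_zero, hq.tendsto_nhds L 0]
  intro i ε hε
  obtain ⟨r, hr, h0, hle⟩ := h i
  have : ∀ᶠ y in 𝓝 (0 : Y), r y < ε := hr.continuousAt.eventually_lt_const (by rwa [h0])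
  filter_upwards [this] with y hy
  rw [sub_zero]
  exact (hle y).trans_lt hy

/-- If a map `X' × Z → Y'`, linear in the first argument, is continuous at the origin, then there
is a single neighbourhood of `0` in `Z` on which all the maps `z ↦ ⟨φ, b(T, z)⟩` are bounded. -/
theorem exists_nhds_forall_bounded {X Y Z : Type*} [AddCommGroup X] [Module ℂ X]
    [TopologicalSpace X] [AddCommGroup Y] [Module ℂ Y] [TopologicalSpace Y] [ContinuousSMul ℂ Y]
    [TopologicalSpace Z] [Zero Z] (b : StrongDual ℂ X → Z → StrongDual ℂ Y)
    (hb : Continuous (Function.uncurry b)) (φ : Y) (hs : ∀ (c : ℂ) T z, b (c • T) z φ = c * b T z φ) :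
    ∃ V ∈ 𝓝 (0 : Z), ∀ T, ∃ M, ∀ z ∈ V, ‖b T z φ‖ ≤ M := by
  have h1 : Continuous fun q : StrongDual ℂ X × Z ↦ b q.1 q.2 φ :=
    (continuous_eval_const φ).comp hb
  have h0 : b 0 0 φ = 0 := by simpa [zero_smul ℂ (0 : StrongDual ℂ X)] using hs 0 0 0
  have h2 : ∀ᶠ q in 𝓝 ((0 : StrongDual ℂ X), (0 : Z)), ‖b q.1 q.2 φ‖ < 1 :=
    h1.norm.continuousAt.eventually_lt_const (by simp [h0])
  rw [nhds_prod_eq, eventually_prod_iff] at h2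
  obtain ⟨U, hU, V, hV, hUV⟩ := h2
  refine ⟨{z | V z}, hV, fun T ↦ ?_⟩
  -- `U` absorbs `T`: some nonzero multiple `c • T` lies in it, and homogeneity turns the bound 1
  -- into `‖c‖⁻¹`.
  have h3 : Tendsto (fun c : ℂ ↦ c • T) (𝓝[≠] 0) (𝓝 0) := by
    have : Continuous fun c : ℂ ↦ c • T := continuous_id.smul continuous_const
    simpa [zero_smul ℂ T] using (this.tendsto 0).mono_left nhdsWithin_le_nhds
  obtain ⟨c, hc, hc0⟩ := ((h3.eventually hU).and self_mem_nhdsWithin).exists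
  have hc0 : 0 < ‖c‖ := norm_pos_iff.2 hc0
  refine ⟨‖c‖⁻¹, fun z hz ↦ ?_⟩
  have := hUV hc hz
  rw [hs, norm_mul] at this
  rw [← one_div, le_div_iff₀ hc0, mul_comm]
  exact this.le

section
variable {n : ℕ} {P : Submodule ℂ (Rn n → ℂ)} {hP : ∀ f ∈ P, ContDiff ℝ ∞ f} {A : Set (Rn n)}
  {w : Rn n → ℝ} {m : ℕ}
  {hb : ∀ f ∈ P, BddAbove (Set.range fun x : A ↦ |w x| * ‖iteratedFDeriv ℝ m f x‖)}

theorem supSeminorm_le {f : FnSpace P} {C : ℝ} (hC : 0 ≤ C)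
    (h : ∀ x ∈ A, |w x| * ‖iteratedFDeriv ℝ m f x‖ ≤ C) : supSeminorm hP A w m hb f ≤ C :=
  Real.iSup_le (fun x ↦ h x x.2) hC

theorem le_supSeminorm (f : FnSpace P) {x : Rn n} (hx : x ∈ A) :
    |w x| * ‖iteratedFDeriv ℝ m f x‖ ≤ supSeminorm hP A w m hb f :=
  le_ciSup (hb f f.mem) ⟨x, hx⟩
end

/-! ### Vector space topologies of the function spaces -/

theorem withSeminorms_E (n : ℕ) : WithSeminorms (seminormsE n) := ⟨rfl⟩
theorem withSeminorms_OM (n : ℕ) : WithSeminorms (seminormsOM n) := ⟨rfl⟩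
theorem withSeminorms_step (n k : ℕ) : WithSeminorms (seminormsStep n k) := ⟨rfl⟩

instance (n : ℕ) :
    Nonempty {p : Seminorm ℂ (SpaceOC n) // ∀ k, Continuous fun f ↦ p (stepToOC n k f)} :=
  ⟨⟨0, fun _ ↦ continuous_const⟩⟩

theorem withSeminorms_OC (n : ℕ) : WithSeminorms (seminormsOC n) := ⟨rfl⟩

theorem withSeminorms_DL (n : ℕ) (p : ℝ≥0∞) [hp : Fact (1 ≤ p)] :
    WithSeminorms (fun m : ℕ ↦ lpSeminorm hp.out (le_refl (lpSub n p)) m) := ⟨rfl⟩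

theorem withSeminorms_DLDot (n : ℕ) (p : ℝ≥0∞) [hp : Fact (1 ≤ p)] :
    WithSeminorms (fun m : ℕ ↦ lpSeminorm (P := lpDotSub n p) hp.out (fun _ hf ↦ hf.1) m) := ⟨rfl⟩

instance (n : ℕ) : IsTopologicalAddGroup (SpaceE n) := (withSeminorms_E n).topologicalAddGroup
instance (n : ℕ) : ContinuousSMul ℂ (SpaceE n) := (withSeminorms_E n).continuousSMul
instance (n : ℕ) : IsTopologicalAddGroup (SpaceOM n) := (withSeminorms_OM n).topologicalAddGroup
instance (n : ℕ) : ContinuousSMul ℂ (SpaceOM n) := (withSeminorms_OM n).continuousSMul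
instance (n : ℕ) : IsTopologicalAddGroup (SpaceOC n) := (withSeminorms_OC n).topologicalAddGroup
instance (n : ℕ) : ContinuousSMul ℂ (SpaceOC n) := (withSeminorms_OC n).continuousSMul
instance (n k : ℕ) : IsTopologicalAddGroup (FnSpace (stepSub n k)) :=
  (withSeminorms_step n k).topologicalAddGroup
instance (n k : ℕ) : ContinuousSMul ℂ (FnSpace (stepSub n k)) :=
  (withSeminorms_step n k).continuousSMul
instance (n : ℕ) (p : ℝ≥0∞) [Fact (1 ≤ p)] : IsTopologicalAddGroup (SpaceDL n p) :=
  (withSeminorms_DL n p).topologicalAddGroup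
instance (n : ℕ) (p : ℝ≥0∞) [Fact (1 ≤ p)] : ContinuousSMul ℂ (SpaceDL n p) :=
  (withSeminorms_DL n p).continuousSMul
instance (n : ℕ) (p : ℝ≥0∞) [Fact (1 ≤ p)] : IsTopologicalAddGroup (SpaceDLDot n p) :=
  (withSeminorms_DLDot n p).topologicalAddGroup
instance (n : ℕ) (p : ℝ≥0∞) [Fact (1 ≤ p)] : ContinuousSMul ℂ (SpaceDLDot n p) :=
  (withSeminorms_DLDot n p).continuousSMul

/-- Complex scalar multiplication is assembled from real scalar multiplication and the continuous
operator `φ ↦ iφ`. -/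
instance (n : ℕ) : ContinuousSMul ℂ (SpaceD n) where
  continuous_smul := by
    have hI : Continuous fun φ : SpaceD n ↦ Complex.I • φ :=
      (TestFunction.postcompCLM (𝕜 := ℂ) (Ω := (⊤ : TopologicalSpace.Opens (Rn n))) (n := ⊤)
        (Complex.I • ContinuousLinearMap.id ℂ ℂ)).continuous
    have h : (fun q : ℂ × SpaceD n ↦ q.1 • q.2)
        = fun q ↦ q.1.re • q.2 + q.1.im • (Complex.I • q.2) := by
      ext q x
      change q.1 * q.2 x = (q.1.re : ℝ) • q.2 x + (q.1.im : ℝ) • (Complex.I * q.2 x)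
      conv_lhs => rw [← Complex.re_add_im q.1]
      simp only [Complex.real_smul]
      ring
    rw [h]
    exact ((Complex.continuous_re.comp continuous_fst).smul continuous_snd).add
      ((Complex.continuous_im.comp continuous_fst).smul (hI.comp continuous_snd))

/-! ### Plane waves in `𝓓_{L^∞}` -/

theorem iteratedDeriv_cexp_mul (c : ℂ) (m : ℕ) :
    iteratedDeriv m (fun t : ℝ ↦ Complex.exp (c * t)) = fun t : ℝ ↦ c ^ m * Complex.exp (c * t) := by
  induction m with
  | zero => simp
  | succ m ih =>
    rw [iteratedDeriv_succ, ih]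
    ext t
    have h : HasDerivAt (fun t : ℝ ↦ c * (t : ℂ)) c t := by
      simpa using (Complex.ofRealCLM.hasDerivAt (x := t)).const_mul c
    rw [(h.cexp.const_mul (c ^ m)).deriv]
    ring

/-- The plane wave `x ↦ exp(i l x_j)`. -/
def planeWave {n : ℕ} (j : Fin n) (l : ℝ) (x : Rn n) : ℂ := Complex.exp (Complex.I * l * (x j : ℝ))

theorem planeWave_eq_comp {n : ℕ} (j : Fin n) (l : ℝ) :
    planeWave j l = (fun t : ℝ ↦ Complex.exp (Complex.I * l * t)) ∘ EuclideanSpace.proj (𝕜 := ℝ) j :=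
  rfl

theorem contDiff_cexp_mul (c : ℂ) : ContDiff ℝ ∞ fun t : ℝ ↦ Complex.exp (c * t) :=
  (contDiff_const.mul Complex.ofRealCLM.contDiff).cexp

theorem contDiff_planeWave {n : ℕ} (j : Fin n) (l : ℝ) : ContDiff ℝ ∞ (planeWave j l) := by
  rw [planeWave_eq_comp]
  exact (contDiff_cexp_mul _).comp (EuclideanSpace.proj (𝕜 := ℝ) j : Rn n →L[ℝ] ℝ).contDiff

theorem norm_iteratedDeriv_cexp (l : ℝ) (m : ℕ) (t : ℝ) :
    ‖iteratedDeriv m (fun t : ℝ ↦ Complex.exp (Complex.I * l * t)) t‖ = |l| ^ m := by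
  rw [iteratedDeriv_cexp_mul, norm_mul, norm_pow, norm_mul, Complex.norm_I, one_mul,
    mul_comm Complex.I, mul_right_comm, ← Complex.ofReal_mul, Complex.norm_exp_ofReal_mul_I, mul_one,
    Complex.norm_real, Real.norm_eq_abs]

/-- The coordinate projection has norm at most 1, which gives `≤`; inserting the unit vector `e_j`
in all slots gives `≥`. -/
theorem norm_iteratedFDeriv_planeWave {n : ℕ} (j : Fin n) (l : ℝ) (m : ℕ) (x : Rn n) :
    ‖iteratedFDeriv ℝ m (planeWave j l) x‖ = |l| ^ m := by
  rw [planeWave_eq_comp, (EuclideanSpace.proj j).iteratedFDeriv_comp_right (contDiff_cexp_mul _) x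
    (mod_cast le_top)]
  apply le_antisymm
  · refine (ContinuousMultilinearMap.norm_compContinuousLinearMap_le _ _).trans ?_
    rw [norm_iteratedFDeriv_eq_norm_iteratedDeriv, norm_iteratedDeriv_cexp]
    refine mul_le_of_le_one_right (by positivity) (Finset.prod_le_one (fun _ _ ↦ norm_nonneg _) ?_)
    intro _ _
    refine ContinuousLinearMap.opNorm_le_bound _ zero_le_one fun y ↦ ?_
    rw [one_mul]
    exact PiLp.norm_apply_le y j
  · have h := ContinuousMultilinearMap.le_opNorm
      ((iteratedFDeriv ℝ m (fun t : ℝ ↦ Complex.exp (Complex.I * l * t))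
        (EuclideanSpace.proj (𝕜 := ℝ) j x)).compContinuousLinearMap
        fun _ ↦ EuclideanSpace.proj (𝕜 := ℝ) j) fun _ ↦ EuclideanSpace.single j (1 : ℝ)
    rw [ContinuousMultilinearMap.compContinuousLinearMap_apply] at h
    have h1 : EuclideanSpace.proj (𝕜 := ℝ) j (EuclideanSpace.single j (1 : ℝ)) = 1 := by simp
    simp only [h1, PiLp.norm_single, norm_one, Finset.prod_const_one, mul_one] at h
    rw [← iteratedDeriv_eq_iteratedFDeriv, norm_iteratedDeriv_cexp] at h
    exact h

/-- A smooth function with bounded derivatives belongs to `𝓓_{L^∞}`. -/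
theorem mem_lpSub_top {n : ℕ} {f : Rn n → ℂ} (hf : ContDiff ℝ ∞ f)
    (h : ∀ m, ∃ C, ∀ x, ‖iteratedFDeriv ℝ m f x‖ ≤ C) : f ∈ lpSub n ⊤ := by
  refine ⟨hf, fun m ↦ ?_⟩
  obtain ⟨C, hC⟩ := h m
  exact memLp_top_of_bound (continuous_iteratedFDeriv_of_smooth hf m).aestronglyMeasurable C
    (.of_forall hC)

/-- The essential supremum bounds the derivative on a dense set, hence everywhere by continuity. -/
theorem norm_iteratedFDeriv_le_lpSeminorm_top {n : ℕ} {P : Submodule ℂ (Rn n → ℂ)}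
    (hP : P ≤ lpSub n ⊤) (m : ℕ) (f : FnSpace P) (x : Rn n) :
    ‖iteratedFDeriv ℝ m f x‖ ≤ lpSeminorm le_top hP m f := by
  have hf := hP f.mem
  have hae : ∀ᵐ y ∂(volume : Measure (Rn n)),
      ‖iteratedFDeriv ℝ m f y‖ ≤ lpSeminorm le_top hP m f := by
    filter_upwards [ae_le_eLpNormEssSup (f := iteratedFDeriv ℝ m f)] with y hy
    rw [← toReal_enorm]
    refine ENNReal.toReal_mono (hf.2 m).eLpNorm_ne_top ?_
    rwa [eLpNorm_exponent_top]
  have hd := Measure.dense_of_ae hae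
  have hc : IsClosed {y | ‖iteratedFDeriv ℝ m f y‖ ≤ lpSeminorm le_top hP m f} :=
    isClosed_le (continuous_iteratedFDeriv_of_smooth hf.1 m).norm continuous_const
  exact (hc.closure_eq ▸ hd x :)

theorem lpSeminorm_top_le {n : ℕ} {P : Submodule ℂ (Rn n → ℂ)} (hP : P ≤ lpSub n ⊤) {m : ℕ}
    {f : FnSpace P} {C : ℝ} (hC : 0 ≤ C) (h : ∀ x, ‖iteratedFDeriv ℝ m f x‖ ≤ C) :
    lpSeminorm le_top hP m f ≤ C := by
  change (eLpNorm (iteratedFDeriv ℝ m f) ⊤ volume).toReal ≤ C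
  rw [← ENNReal.toReal_ofReal hC, eLpNorm_exponent_top]
  exact ENNReal.toReal_mono ENNReal.ofReal_ne_top (eLpNormEssSup_le_of_ae_bound (.of_forall h))

/-- In every neighbourhood of `0` in `𝓓_{L^∞}` there are plane waves whose derivatives of some
order are arbitrarily large. -/
theorem exists_planeWave_mem_nhds {n : ℕ} (j : Fin n) {V : Set (SpaceDL n ⊤)} (hV : V ∈ 𝓝 0) :
    ∃ (m : ℕ) (δ : ℝ), 0 < δ ∧ ∀ k : ℕ, ∃ g ∈ V,
      ∀ x, ‖iteratedFDeriv ℝ m g x‖ = δ * (k + 1) := by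
  rw [(withSeminorms_DL n ⊤).mem_nhds_iff] at hV
  obtain ⟨s, r, hr, hsV⟩ := hV
  obtain ⟨m, hm⟩ := s.bddAbove
  -- The neighbourhood involves only orders up to `m`; order `m + 1` is free to grow.
  refine ⟨m + 1, r / 2, by positivity, fun k ↦ ?_⟩
  have hk1 : (1 : ℝ) ≤ k + 1 := le_add_of_nonneg_left k.cast_nonneg
  have hk : (0 : ℝ) < k + 1 := by positivity
  -- At frequency `k + 1 ≥ 1` the order `m` dominates all lower ones, so this factor brings every
  -- order up to `m` below `r / 2`, while order `m + 1` becomes `r / 2 * (k + 1)`.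
  set c : ℂ := ((r / 2 * ((k + 1 : ℝ) ^ m)⁻¹ : ℝ) : ℂ) with hc
  have hcn : ‖c‖ = r / 2 * ((k + 1 : ℝ) ^ m)⁻¹ := by
    rw [hc, Complex.norm_real, Real.norm_of_nonneg (by positivity)]
  have hsm := contDiff_planeWave j (k + 1 : ℝ)
  have hD : ∀ (i : ℕ) (x : Rn n), ‖iteratedFDeriv ℝ i (c • planeWave j (k + 1 : ℝ)) x‖
      = r / 2 * ((k + 1 : ℝ) ^ m)⁻¹ * (k + 1) ^ i := by
    intro i x
    rw [iteratedFDeriv_smul_of_smooth hsm, Pi.smul_apply, norm_smul, norm_iteratedFDeriv_planeWave,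
      hcn, abs_of_pos hk]
  let g : SpaceDL n ⊤ := ⟨c • planeWave j (k + 1 : ℝ),
    mem_lpSub_top (hsm.const_smul c) fun i ↦ ⟨_, fun x ↦ (hD i x).le⟩⟩
  refine ⟨g, hsV ?_, fun x ↦ ?_⟩
  · rw [Seminorm.mem_ball_zero]
    refine (Seminorm.finset_sup_apply_le (a := r / 2) (by positivity) fun i hi ↦ ?_).trans_lt
      (by linarith)
    refine lpSeminorm_top_le _ (by positivity) fun x ↦ (hD i x).trans_le ?_
    have h1 : (k + 1 : ℝ) ^ i ≤ (k + 1) ^ m := pow_le_pow_right₀ hk1 (hm hi)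
    calc r / 2 * ((k + 1 : ℝ) ^ m)⁻¹ * (k + 1) ^ i ≤ r / 2 * ((k + 1 : ℝ) ^ m)⁻¹ * (k + 1) ^ m := by
          gcongr
      _ = r / 2 := by field_simp
  · refine (hD (m + 1) x).trans ?_
    field_simp
    ring

/-! ### The discontinuity criterion for multiplications -/

/-- Every order of derivation is controlled from below, on the unit ball, by a continuous
seminorm. -/
def ControlsDerivatives (n : ℕ) (X : Type) [AddCommGroup X] [Module ℂ X] [TopologicalSpace X]
    [FunLike X (Rn n) ℂ] : Prop :=
  ∀ m : ℕ, ∃ p : Seminorm ℂ X, Continuous p ∧ ∃ c : ℝ, 0 < c ∧ ∀ (r : ℝ) (φ : X), 0 ≤ r →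
    (∀ x ∈ Metric.ball (0 : Rn n) 1, r ≤ ‖iteratedFDeriv ℝ m φ x‖) → c * r ≤ p φ

/-- Continuity would make the products of φ with the plane waves in a neighbourhood of 0 weakly
bounded in `X`, hence bounded, contradicting the growth of their derivatives of order `m` on the
unit ball. -/
theorem not_continuous_of_isMultiplication {n : ℕ} (hn : 1 ≤ n) {X M Y : Type} [AddCommGroup X]
    [Module ℂ X] [TopologicalSpace X] [IsTopologicalAddGroup X] [FunLike X (Rn n) ℂ]
    [TopologicalSpace M] [Zero M] [FunLike M (Rn n) ℂ] [AddCommGroup Y] [Module ℂ Y]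
    [TopologicalSpace Y] [ContinuousSMul ℂ Y] [FunLike Y (Rn n) ℂ]
    (hX : ControlsDerivatives n X) (ι : SpaceDL n ⊤ → M) (hι : Continuous ι) (hι0 : ι 0 = 0)
    (hιf : ∀ f x, ι f x = f x)
    (hY : ∃ φ : Y, ∀ x ∈ Metric.ball (0 : Rn n) 1, φ x = 1)
    (b : StrongDual ℂ X → M → StrongDual ℂ Y) (hb : IsMultiplication n b) :
    ¬ Continuous (Function.uncurry b) := by
  intro hcont
  obtain ⟨φ, hφ⟩ := hY
  have hs : ∀ (c : ℂ) T z, b (c • T) z φ = c * b T z φ := by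
    intro c T z
    obtain ⟨ψ, h1, h2⟩ := hb (c • T) z φ
    obtain ⟨χ, h3, h4⟩ := hb T z φ
    have : ψ = χ := DFunLike.ext _ _ fun x ↦ (h1 x).trans (h3 x).symm
    rw [h2, h4, this]
    rfl
  obtain ⟨V, hV, hbd⟩ := exists_nhds_forall_bounded b hcont φ hs
  have hV' : ι ⁻¹' V ∈ 𝓝 (0 : SpaceDL n ⊤) := hι.continuousAt (by rwa [hι0])
  obtain ⟨m, δ, hδ, hg⟩ := exists_planeWave_mem_nhds (⟨0, hn⟩ : Fin n) hV'
  choose g hgV hgD using hg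
  choose ψ hψ hbψ using fun (T : StrongDual ℂ X) (k : ℕ) ↦ hb T (ι (g k)) φ
  -- The product of `g k` and φ does not depend on `T`; this gives one sequence in `X` to which
  -- uniform boundedness applies.
  have hψ0 : ∀ T k, ψ T k = ψ 0 k :=
    fun T k ↦ DFunLike.ext _ _ fun x ↦ (hψ T k x).trans (hψ 0 k x).symm
  obtain ⟨p, hp, c, hc, hpc⟩ := hX m
  obtain ⟨C, hC⟩ := p.exists_bound_of_forall_strongDual hp (ψ 0) fun T ↦ by
    obtain ⟨C, hC⟩ := hbd T
    refine ⟨C, fun k ↦ ?_⟩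
    rw [← hψ0 T k, ← hbψ]
    exact hC _ (hgV k)
  obtain ⟨k, hk⟩ := exists_nat_gt (C / (c * δ))
  have h1 : c * (δ * (k + 1)) ≤ C := by
    refine (hpc _ _ (by positivity) fun x hx ↦ ?_).trans (hC k)
    -- Since φ = 1 near x, the product and the plane wave have the same derivatives there.
    have : (ψ 0 k : Rn n → ℂ) =ᶠ[𝓝 x] g k := by
      filter_upwards [Metric.isOpen_ball.mem_nhds hx] with y hy
      rw [hψ, hιf, hφ y hy, mul_one]
    rw [(this.iteratedFDeriv ℝ m).eq_of_nhds, hgD]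
  rw [div_lt_iff₀ (by positivity)] at hk
  have : 0 < c * δ := by positivity
  nlinarith

/-- The product `fT` is the transpose of multiplication by f, applied to `T`. -/
theorem exists_isMultiplication {n : ℕ} {X M Y : Type} [AddCommGroup X] [Module ℂ X]
    [TopologicalSpace X] [FunLike X (Rn n) ℂ] [FunLike M (Rn n) ℂ] [AddCommGroup Y] [Module ℂ Y]
    [TopologicalSpace Y] [FunLike Y (Rn n) ℂ]
    (h : ∀ f : M, ∃ L : Y →L[ℂ] X, ∀ φ x, L φ x = f x * φ x) :
    ∃ b : StrongDual ℂ X → M → StrongDual ℂ Y, IsMultiplication n b := by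
  choose L hL using h
  exact ⟨fun T f ↦ T.comp (L f), fun T f φ ↦ ⟨L f φ, hL f φ, rfl⟩⟩

/-! ### Cut-off functions and lower bounds for seminorms -/

theorem exists_cutoff (n : ℕ) : ∃ f : Rn n → ℂ, ContDiff ℝ ∞ f ∧ HasCompactSupport f ∧
    ∀ x ∈ Metric.ball (0 : Rn n) 1, f x = 1 := by
  let χ : ContDiffBump (0 : Rn n) := ⟨1, 2, one_pos, one_lt_two⟩
  refine ⟨fun x ↦ (χ x : ℂ), Complex.ofRealCLM.contDiff.comp χ.contDiff,
    χ.hasCompactSupport.comp_left Complex.ofReal_zero, fun x hx ↦ ?_⟩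
  change ((χ x : ℝ) : ℂ) = 1
  rw [χ.one_of_mem_closedBall (Metric.ball_subset_closedBall hx), Complex.ofReal_one]

theorem exists_schwartz_cutoff (n : ℕ) :
    ∃ φ : 𝓢(Rn n, ℂ), ∀ x ∈ Metric.ball (0 : Rn n) 1, φ x = 1 := by
  obtain ⟨f, h1, h2, h3⟩ := exists_cutoff n
  exact ⟨h2.toSchwartzMap h1, h3⟩

theorem memLp_iteratedFDeriv_of_hasCompactSupport {n : ℕ} {f : Rn n → ℂ} (hf : ContDiff ℝ ∞ f)
    (hs : HasCompactSupport f) (m : ℕ) (p : ℝ≥0∞) : MemLp (iteratedFDeriv ℝ m f) p volume :=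
  (continuous_iteratedFDeriv_of_smooth hf m).memLp_of_hasCompactSupport (hs.iteratedFDeriv m)

theorem tendsto_cocompact_of_hasCompactSupport {n : ℕ} {F : Type*} [NormedAddCommGroup F]
    {f : Rn n → F} (hs : HasCompactSupport f) : Tendsto f (cocompact (Rn n)) (𝓝 0) := by
  refine tendsto_const_nhds.congr' ?_
  filter_upwards [hs.isCompact.compl_mem_cocompact] with x hx
  exact (image_eq_zero_of_notMem_tsupport hx).symm

theorem exists_cutoff_E (n : ℕ) :
    ∃ φ : SpaceE n, ∀ x ∈ Metric.ball (0 : Rn n) 1, φ x = 1 := by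
  obtain ⟨f, h1, h2, h3⟩ := exists_cutoff n
  exact ⟨⟨f, h1⟩, h3⟩

theorem exists_cutoff_OM (n : ℕ) :
    ∃ φ : SpaceOM n, ∀ x ∈ Metric.ball (0 : Rn n) 1, φ x = 1 := by
  obtain ⟨φ, h⟩ := exists_schwartz_cutoff n
  exact ⟨⟨φ, φ.hasTemperateGrowth⟩, h⟩

theorem exists_cutoff_OC (n : ℕ) :
    ∃ φ : SpaceOC n, ∀ x ∈ Metric.ball (0 : Rn n) 1, φ x = 1 := by
  obtain ⟨f, h1, h2, h3⟩ := exists_cutoff n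
  refine ⟨⟨f, 0, h1, fun m ↦ ?_⟩, h3⟩
  simpa using tendsto_cocompact_of_hasCompactSupport (h2.iteratedFDeriv (𝕜 := ℝ) m)

theorem exists_cutoff_DLDot (n : ℕ) (p : ℝ≥0∞) :
    ∃ φ : SpaceDLDot n p, ∀ x ∈ Metric.ball (0 : Rn n) 1, φ x = 1 := by
  obtain ⟨f, h1, h2, h3⟩ := exists_cutoff n
  exact ⟨⟨f, ⟨h1, fun m ↦ memLp_iteratedFDeriv_of_hasCompactSupport h1 h2 m p⟩,
    fun _ m ↦ tendsto_cocompact_of_hasCompactSupport (h2.iteratedFDeriv m)⟩, h3⟩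

theorem exists_cutoff_D (n : ℕ) :
    ∃ φ : SpaceD n, ∀ x ∈ Metric.ball (0 : Rn n) 1, φ x = 1 := by
  obtain ⟨f, h1, h2, h3⟩ := exists_cutoff n
  exact ⟨⟨f, h1, h2, fun _ _ ↦ trivial⟩, h3⟩

theorem controlsDerivatives_E (n : ℕ) : ControlsDerivatives n (SpaceE n) := by
  intro m
  refine ⟨seminormsE n (⟨{0}, isCompact_singleton⟩, m),
    (withSeminorms_E n).continuous_seminorm _, 1, one_pos, fun r φ _ h ↦ ?_⟩
  refine (one_mul r).trans_le ((h 0 (Metric.mem_ball_self one_pos)).trans ?_)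
  refine le_trans ?_ (le_supSeminorm φ (x := 0) rfl)
  simp

theorem controlsDerivatives_OM (n : ℕ) : ControlsDerivatives n (SpaceOM n) := by
  intro m
  obtain ⟨ψ, hψ⟩ := exists_schwartz_cutoff n
  refine ⟨seminormsOM n (ψ, m), (withSeminorms_OM n).continuous_seminorm _, 1, one_pos,
    fun r φ _ h ↦ ?_⟩
  refine (one_mul r).trans_le ((h 0 (Metric.mem_ball_self one_pos)).trans ?_)
  refine le_trans ?_ (le_supSeminorm φ (x := 0) (Set.mem_univ _))
  simp [hψ]

def stepToOCₗ (n k : ℕ) : FnSpace (stepSub n k) →ₗ[ℂ] SpaceOC n where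
  toFun := stepToOC n k
  map_add' _ _ := rfl
  map_smul' _ _ := rfl

/-- Each defining seminorm of `𝓞_C` restricts continuously to the steps by definition. -/
theorem continuous_stepToOC (n k : ℕ) : Continuous (stepToOC n k) :=
  continuous_of_seminorm_le (withSeminorms_OC n) (stepToOCₗ n k) fun p ↦
    ⟨_, p.2 k, map_zero (p.1.comp (stepToOCₗ n k)), fun _ ↦ le_rfl⟩

/-- The evaluation seminorm `f ↦ ‖D^m f(0)‖`. -/
def evalSeminormOC (n m : ℕ) : Seminorm ℂ (SpaceOC n) :=
  supSeminorm (fun _ ⟨_, hf⟩ ↦ hf.1) {0} (fun _ ↦ 1) m fun _ _ ↦ (Set.finite_range _).bddAbove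

/-- The weight `(1 + |x|²)^{-k}` equals 1 at the origin for every `k`, so evaluation there is
continuous on all steps. -/
theorem controlsDerivatives_OC (n : ℕ) : ControlsDerivatives n (SpaceOC n) := by
  intro m
  have hp : ∀ k, Continuous fun f ↦ evalSeminormOC n m (stepToOC n k f) := by
    intro k
    have hq := (withSeminorms_step n k).continuous_seminorm m
    refine Seminorm.continuous_of_le (p := (evalSeminormOC n m).comp (stepToOCₗ n k)) hq ?_
    intro f
    change evalSeminormOC n m (stepToOC n k f) ≤ seminormsStep n k m f
    refine supSeminorm_le (apply_nonneg (seminormsStep n k m) f) ?_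
    rintro x rfl
    refine le_trans ?_ (le_supSeminorm f (x := 0) (Set.mem_univ _))
    change |(1 : ℝ)| * ‖iteratedFDeriv ℝ m f 0‖ ≤ _
    simp
  refine ⟨evalSeminormOC n m, (withSeminorms_OC n).continuous_seminorm ⟨_, hp⟩, 1, one_pos,
    fun r φ _ h ↦ ?_⟩
  refine (one_mul r).trans_le ((h 0 (Metric.mem_ball_self one_pos)).trans ?_)
  refine le_trans ?_ (le_supSeminorm φ (x := 0) rfl)
  simp

theorem controlsDerivatives_S (n : ℕ) : ControlsDerivatives n 𝓢(Rn n, ℂ) := by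
  intro m
  refine ⟨SchwartzMap.seminorm ℂ 0 m, (schwartz_withSeminorms ℂ _ _).continuous_seminorm (0, m), 1,
    one_pos, fun r φ _ h ↦ ?_⟩
  exact (one_mul r).trans_le ((h 0 (Metric.mem_ball_self one_pos)).trans
    (φ.norm_iteratedFDeriv_le_seminorm ℂ m 0))

/-- A function of modulus at least r on the unit ball `B` has `L^p` norm at least `r |B|^{1/p}`. -/
theorem controlsDerivatives_DLDot (n : ℕ) (p : ℝ≥0∞) [hp : Fact (1 ≤ p)] :
    ControlsDerivatives n (SpaceDLDot n p) := by
  intro m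
  have hp0 : p ≠ 0 := (zero_lt_one.trans_le hp.out).ne'
  set B := Metric.ball (0 : Rn n) 1 with hB
  have hv0 : volume B ≠ 0 := (Metric.measure_ball_pos _ _ one_pos).ne'
  have hvt : volume B ≠ ⊤ := measure_ball_lt_top.ne
  -- For `p = ∞`, `p.toReal = 0` and `1 / 0 = 0`, so the constant is 1, as it should be.
  have hc0 : volume B ^ (1 / p.toReal) ≠ 0 := by simp [ENNReal.rpow_eq_zero_iff, hv0, hvt]
  have hct : volume B ^ (1 / p.toReal) ≠ ⊤ := by simp [ENNReal.rpow_eq_top_iff, hv0, hvt]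
  refine ⟨lpSeminorm (P := lpDotSub n p) hp.out (fun _ hf ↦ hf.1) m,
    (withSeminorms_DLDot n p).continuous_seminorm m, (volume B ^ (1 / p.toReal)).toReal,
    ENNReal.toReal_pos hc0 hct, fun r φ hr h ↦ ?_⟩
  change _ ≤ (eLpNorm (iteratedFDeriv ℝ m φ) p volume).toReal
  have hle : eLpNorm (B.indicator fun _ ↦ r) p volume ≤ eLpNorm (iteratedFDeriv ℝ m φ) p volume := by
    refine eLpNorm_mono fun x ↦ ?_
    by_cases hx : x ∈ B
    · rw [Set.indicator_of_mem hx, Real.norm_of_nonneg hr]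
      exact h x hx
    · rw [Set.indicator_of_notMem hx, norm_zero]
      exact norm_nonneg _
  rw [eLpNorm_indicator_const' measurableSet_ball hv0 hp0] at hle
  have := ENNReal.toReal_mono (φ.mem.1.2 m).eLpNorm_ne_top hle
  rwa [ENNReal.toReal_mul, toReal_enorm, Real.norm_of_nonneg hr, mul_comm] at this

instance (n : ℕ) : ContinuousSMul ℝ (SpaceE n) := IsScalarTower.continuousSMul ℂ

instance (n : ℕ) : LocallyConvexSpace ℝ (SpaceE n) := (withSeminorms_E n).toLocallyConvexSpace

/-- The inclusion `𝓓 → 𝓔`. -/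
def inclDE (n : ℕ) : SpaceD n →L[ℂ] SpaceE n :=
  TestFunction.mkCLM ℂ (fun φ ↦ ⟨φ, φ.contDiff⟩) (fun _ _ ↦ rfl) (fun _ _ ↦ rfl) fun K hK ↦ by
    let L : ContDiffMapSupportedIn (Rn n) ℂ ⊤ K →ₗ[ℂ] SpaceE n :=
      ⟨⟨fun φ ↦ ⟨φ, φ.contDiff⟩, fun _ _ ↦ rfl⟩, fun _ _ ↦ rfl⟩
    refine continuous_of_seminorm_le (withSeminorms_E n) L fun i ↦
      ⟨fun φ ↦ ContDiffMapSupportedIn.seminorm ℂ (Rn n) ℂ ⊤ K i.2 φ,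
        (ContDiffMapSupportedIn.withSeminorms ℂ (Rn n) ℂ ⊤ K).continuous_seminorm i.2,
        map_zero _, fun φ ↦ ?_⟩
    refine supSeminorm_le (apply_nonneg _ _) fun x _ ↦ ?_
    rw [abs_one, one_mul]
    exact ContDiffMapSupportedIn.norm_iteratedFDeriv_apply_le_seminorm_top ℂ

/-- The seminorms found for `𝓔` pull back along the continuous inclusion `𝓓 → 𝓔`. -/
theorem controlsDerivatives_D (n : ℕ) : ControlsDerivatives n (SpaceD n) := by
  intro m
  obtain ⟨p, hp, c, hc, h⟩ := controlsDerivatives_E n m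
  exact ⟨p.comp (inclDE n).toLinearMap, hp.comp (inclDE n).continuous, c, hc,
    fun r φ hr hφ ↦ h r (inclDE n φ) hr hφ⟩

/-! ### Inclusions of `𝓓_{L^∞}` -/

theorem DL_top_bound {n : ℕ} (f : SpaceDL n ⊤) (m : ℕ) (x : Rn n) :
    ‖iteratedFDeriv ℝ m f x‖ ≤ lpSeminorm le_top (le_refl (lpSub n ⊤)) m f :=
  norm_iteratedFDeriv_le_lpSeminorm_top _ m f x

theorem continuous_lpSeminorm_top (n m : ℕ) :
    Continuous (lpSeminorm le_top (le_refl (lpSub n ⊤)) m) :=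
  (withSeminorms_DL n ⊤).continuous_seminorm m

def inclDLtoE (n : ℕ) : SpaceDL n ⊤ →ₗ[ℂ] SpaceE n :=
  ⟨⟨fun f ↦ ⟨f, f.mem.1⟩, fun _ _ ↦ rfl⟩, fun _ _ ↦ rfl⟩

theorem continuous_inclDLtoE (n : ℕ) : Continuous (inclDLtoE n) :=
  continuous_of_seminorm_le (withSeminorms_E n) _ fun i ↦
    ⟨_, continuous_lpSeminorm_top n i.2, map_zero _, fun f ↦ supSeminorm_le (apply_nonneg _ _)
      fun x _ ↦ by rw [abs_one, one_mul]; exact DL_top_bound f _ x⟩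

def inclDLtoOM (n : ℕ) : SpaceDL n ⊤ →ₗ[ℂ] SpaceOM n :=
  ⟨⟨fun f ↦ ⟨f, f.mem.1, fun m ↦ ⟨0, _, fun x ↦ by
    rw [pow_zero, mul_one]; exact DL_top_bound f m x⟩⟩, fun _ _ ↦ rfl⟩, fun _ _ ↦ rfl⟩

theorem continuous_inclDLtoOM (n : ℕ) : Continuous (inclDLtoOM n) := by
  refine continuous_of_seminorm_le (withSeminorms_OM n) _ fun i ↦
    ⟨fun f ↦ SchwartzMap.seminorm ℂ 0 0 i.1 * lpSeminorm le_top (le_refl (lpSub n ⊤)) i.2 f,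
      (continuous_lpSeminorm_top n i.2).const_mul _, by simp, fun f ↦ supSeminorm_le
      (mul_nonneg (apply_nonneg _ _) (apply_nonneg _ _)) fun x _ ↦ ?_⟩
  rw [abs_norm]
  exact mul_le_mul (i.1.norm_le_seminorm ℂ x) (DL_top_bound f _ x) (norm_nonneg _)
    (apply_nonneg _ _)

theorem one_add_norm_sq_pow_inv_le_one {n : ℕ} (x : Rn n) (k : ℕ) : ((1 + ‖x‖ ^ 2) ^ k)⁻¹ ≤ 1 :=
  inv_le_one_of_one_le₀ (one_le_pow₀ (le_add_of_nonneg_right (by positivity)))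

/-- Step 1 is needed: bounded derivatives tend to 0 after division by `1 + |x|²`, whereas step 0
would require them to vanish at infinity. -/
def inclDLtoStep (n : ℕ) : SpaceDL n ⊤ →ₗ[ℂ] FnSpace (stepSub n 1) :=
  ⟨⟨fun f ↦ ⟨f, f.mem.1, fun m ↦ by
    have h1 : Tendsto (fun x : Rn n ↦ 1 + ‖x‖ ^ 2) (cocompact (Rn n)) atTop :=
      tendsto_atTop_add_const_left _ _
        ((tendsto_pow_atTop two_ne_zero).comp tendsto_norm_cocompact_atTop)
    have h2 := h1.inv_tendsto_atTop.mul_const (lpSeminorm le_top (le_refl (lpSub n ⊤)) m f)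
    rw [zero_mul] at h2
    refine squeeze_zero_norm (fun x ↦ ?_) h2
    rw [norm_smul, pow_one, Real.norm_of_nonneg (by positivity)]
    exact mul_le_mul_of_nonneg_left (DL_top_bound f m x) (by positivity)⟩,
    fun _ _ ↦ rfl⟩, fun _ _ ↦ rfl⟩

theorem continuous_inclDLtoStep (n : ℕ) : Continuous (inclDLtoStep n) :=
  continuous_of_seminorm_le (withSeminorms_step n 1) _ fun m ↦
    ⟨_, continuous_lpSeminorm_top n m, map_zero _, fun f ↦ supSeminorm_le (apply_nonneg _ _)
      fun x _ ↦ by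
        rw [abs_of_nonneg (by positivity)]
        exact (mul_le_of_le_one_left (norm_nonneg _) (one_add_norm_sq_pow_inv_le_one x 1)).trans
          (DL_top_bound f _ x)⟩

/-! ### Multiplication operators -/

def FnSpace.mulLM {n : ℕ} {P Q : Submodule ℂ (Rn n → ℂ)} (f : Rn n → ℂ)
    (h : ∀ φ ∈ P, (fun x ↦ f x * φ x) ∈ Q) : FnSpace P →ₗ[ℂ] FnSpace Q where
  toFun φ := ⟨fun x ↦ f x * φ x, h φ φ.mem⟩
  map_add' φ ψ := Subtype.ext (funext fun x ↦ mul_add (f x) (φ x) (ψ x))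
  map_smul' c φ := Subtype.ext (funext fun x ↦ mul_left_comm (f x) c (φ x))

theorem norm_iteratedFDeriv_mul_le_of_smooth {n : ℕ} {f g : Rn n → ℂ} (hf : ContDiff ℝ ∞ f)
    (hg : ContDiff ℝ ∞ g) (m : ℕ) (x : Rn n) :
    ‖iteratedFDeriv ℝ m (fun x ↦ f x * g x) x‖ ≤ ∑ i ∈ Finset.range (m + 1),
      (m.choose i : ℝ) * ‖iteratedFDeriv ℝ i f x‖ * ‖iteratedFDeriv ℝ (m - i) g x‖ :=
  norm_iteratedFDeriv_mul_le hf hg x (mod_cast le_top)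

theorem exists_mul_E_E {n : ℕ} (f : SpaceE n) :
    ∃ L : SpaceE n →L[ℂ] SpaceE n, ∀ φ x, L φ x = f x * φ x := by
  have hf : ContDiff ℝ ∞ f := f.mem
  let L : SpaceE n →ₗ[ℂ] SpaceE n := FnSpace.mulLM f fun φ hφ ↦ hf.mul hφ
  refine ⟨⟨L, continuous_of_seminorm_le (withSeminorms_E n) L fun i ↦
    ⟨fun φ ↦ ∑ j ∈ Finset.range (i.2 + 1), (i.2.choose j : ℝ) * seminormsE n (i.1, j) f *
      seminormsE n (i.1, i.2 - j) φ, ?_, by simp, fun φ ↦ ?_⟩⟩, fun _ _ ↦ rfl⟩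
  · exact continuous_finsetSum _ fun j _ ↦
      ((withSeminorms_E n).continuous_seminorm _).const_mul _
  · refine supSeminorm_le (Finset.sum_nonneg fun j _ ↦ by positivity) fun x hx ↦ ?_
    have hle : ∀ (j : ℕ) (g : SpaceE n), ‖iteratedFDeriv ℝ j g x‖ ≤ seminormsE n (i.1, j) g :=
      fun j g ↦ le_trans (by simp) (le_supSeminorm g hx)
    rw [abs_one, one_mul]
    refine (norm_iteratedFDeriv_mul_le_of_smooth hf φ.mem i.2 x).trans (Finset.sum_le_sum fun j _ ↦ ?_)
    gcongr
    · exact hle _ f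
    · exact hle _ φ

/-- Multiplying ψ by `C(2(1 + |x|²))^k`, a smooth majorant of the growth, stays in `𝓢`. Thus
polynomial growth can be absorbed into the weights of `𝓞_M`. -/
theorem exists_schwartz_dominating {n : ℕ} (ψ : 𝓢(Rn n, ℂ)) (k : ℕ) (C : ℝ) :
    ∃ χ : 𝓢(Rn n, ℂ), ∀ x, ‖ψ x‖ * (C * (1 + ‖x‖) ^ k) ≤ ‖χ x‖ := by
  have h1 : Function.HasTemperateGrowth fun x : Rn n ↦ ((C * (2 * (1 + ‖x‖ ^ 2)) ^ k : ℝ) : ℂ) := by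
    refine Function.Complex.hasTemperateGrowth_ofReal.comp ?_
    refine (Function.HasTemperateGrowth.const C).mul (Function.HasTemperateGrowth.pow
      ((Function.HasTemperateGrowth.const 2).mul ((Function.HasTemperateGrowth.const 1).add
        (Function.hasTemperateGrowth_norm_sq (Rn n)))) k)
  refine ⟨SchwartzMap.smulLeftCLM ℂ (fun x : Rn n ↦ ((C * (2 * (1 + ‖x‖ ^ 2)) ^ k : ℝ) : ℂ)) ψ,
    fun x ↦ ?_⟩
  rw [SchwartzMap.smulLeftCLM_apply_apply h1, norm_smul, Complex.norm_real, mul_comm, norm_mul,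
    norm_pow, Real.norm_of_nonneg (show 0 ≤ 2 * (1 + ‖x‖ ^ 2) by positivity)]
  have : 1 + ‖x‖ ≤ 2 * (1 + ‖x‖ ^ 2) := by nlinarith [sq_nonneg (‖x‖ - 1), norm_nonneg x]
  gcongr
  exact le_abs_self C

theorem exists_mul_OM_OM {n : ℕ} (f : SpaceOM n) :
    ∃ L : SpaceOM n →L[ℂ] SpaceOM n, ∀ φ x, L φ x = f x * φ x := by
  have hf : Function.HasTemperateGrowth f := f.mem
  let L : SpaceOM n →ₗ[ℂ] SpaceOM n := FnSpace.mulLM f fun φ hφ ↦ hf.mul hφ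
  refine ⟨⟨L, continuous_of_seminorm_le (withSeminorms_OM n) L ?_⟩, fun _ _ ↦ rfl⟩
  rintro ⟨ψ, m⟩
  choose k C hC using hf.2
  -- In the Leibniz sum each derivative of f is absorbed into its own weight, because its growth
  -- exponent depends on the order.
  choose χ hχ using fun j ↦ exists_schwartz_dominating ψ (k j) (C j)
  refine ⟨fun φ ↦ ∑ j ∈ Finset.range (m + 1), (m.choose j : ℝ) * seminormsOM n (χ j, m - j) φ,
    ?_, by simp, fun φ ↦ ?_⟩
  · exact continuous_finsetSum _ fun j _ ↦
      ((withSeminorms_OM n).continuous_seminorm _).const_mul _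
  · refine supSeminorm_le (Finset.sum_nonneg fun j _ ↦ by positivity) fun x _ ↦ ?_
    have hφ : Function.HasTemperateGrowth φ := φ.mem
    rw [abs_norm]
    calc ‖ψ x‖ * ‖iteratedFDeriv ℝ m (fun x ↦ f x * φ x) x‖
        ≤ ‖ψ x‖ * ∑ j ∈ Finset.range (m + 1),
          (m.choose j : ℝ) * ‖iteratedFDeriv ℝ j f x‖ * ‖iteratedFDeriv ℝ (m - j) φ x‖ := by
          gcongr
          exact norm_iteratedFDeriv_mul_le_of_smooth hf.1 hφ.1 m x
      _ = ∑ j ∈ Finset.range (m + 1), (m.choose j : ℝ) * (‖ψ x‖ * ‖iteratedFDeriv ℝ j f x‖ *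
            ‖iteratedFDeriv ℝ (m - j) φ x‖) := by
          rw [Finset.mul_sum]
          exact Finset.sum_congr rfl fun j _ ↦ by ring
      _ ≤ _ := by
          refine Finset.sum_le_sum fun j _ ↦ mul_le_mul_of_nonneg_left ?_ (Nat.cast_nonneg _)
          refine le_trans ?_ (le_supSeminorm φ (Set.mem_univ x))
          rw [abs_norm]
          gcongr
          exact (mul_le_mul_of_nonneg_left (hC j x) (norm_nonneg _)).trans (hχ j x)

/-- In the Leibniz rule the weight of exponent `l + k` splits between the factors, so multiplication
by an element of step `l` sends step `k` to step `l + k`. -/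
theorem norm_step_mul_le {n : ℕ} {f g : Rn n → ℂ} (hf : ContDiff ℝ ∞ f)
    (hg : ContDiff ℝ ∞ g) (l k m : ℕ) (x : Rn n) :
    ((1 + ‖x‖ ^ 2) ^ (l + k))⁻¹ * ‖iteratedFDeriv ℝ m (fun x ↦ f x * g x) x‖ ≤
      ∑ i ∈ Finset.range (m + 1), (m.choose i : ℝ) *
        (((1 + ‖x‖ ^ 2) ^ l)⁻¹ * ‖iteratedFDeriv ℝ i f x‖) *
        (((1 + ‖x‖ ^ 2) ^ k)⁻¹ * ‖iteratedFDeriv ℝ (m - i) g x‖) := by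
  refine (mul_le_mul_of_nonneg_left (norm_iteratedFDeriv_mul_le_of_smooth hf hg m x)
    (by positivity)).trans_eq ?_
  rw [Finset.mul_sum]
  refine Finset.sum_congr rfl fun i _ ↦ ?_
  rw [pow_add, mul_inv]
  ring

theorem mul_mem_stepSub {n l k : ℕ} {f g : Rn n → ℂ} (hf : f ∈ stepSub n l) (hg : g ∈ stepSub n k) :
    (fun x ↦ f x * g x) ∈ stepSub n (l + k) := by
  refine ⟨hf.1.mul hg.1, fun m ↦ ?_⟩
  have h : ∀ {k : ℕ} {g : Rn n → ℂ}, g ∈ stepSub n k → ∀ i, Tendsto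
      (fun x ↦ ((1 + ‖x‖ ^ 2) ^ k)⁻¹ * ‖iteratedFDeriv ℝ i g x‖) (cocompact (Rn n)) (𝓝 0) := by
    intro k g hg i
    refine (tendsto_zero_iff_norm_tendsto_zero.1 (hg.2 i)).congr fun x ↦ ?_
    rw [norm_smul, Real.norm_of_nonneg (by positivity)]
  have hs : Tendsto (fun x ↦ ∑ i ∈ Finset.range (m + 1), (m.choose i : ℝ) *
        (((1 + ‖x‖ ^ 2) ^ l)⁻¹ * ‖iteratedFDeriv ℝ i f x‖) *
        (((1 + ‖x‖ ^ 2) ^ k)⁻¹ * ‖iteratedFDeriv ℝ (m - i) g x‖)) (cocompact (Rn n))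
        (𝓝 (∑ i ∈ Finset.range (m + 1), (m.choose i : ℝ) * 0 * 0)) :=
    tendsto_finsetSum _ fun i _ ↦ ((h hf i).const_mul _).mul (h hg (m - i))
  simp only [mul_zero, Finset.sum_const_zero] at hs
  refine squeeze_zero_norm (fun x ↦ ?_) hs
  rw [norm_smul, Real.norm_of_nonneg (by positivity)]
  exact norm_step_mul_le hf.1 hg.1 l k m x

theorem continuous_mul_step {n l : ℕ} {f : Rn n → ℂ} (hf : f ∈ stepSub n l) (k : ℕ) :
    Continuous (FnSpace.mulLM (P := stepSub n k) (Q := stepSub n (l + k)) f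
      fun _ hφ ↦ mul_mem_stepSub hf hφ) := by
  refine continuous_of_seminorm_le (withSeminorms_step n (l + k)) _ fun m ↦
    ⟨fun φ ↦ ∑ j ∈ Finset.range (m + 1), (m.choose j : ℝ) * seminormsStep n l j ⟨f, hf⟩ *
      seminormsStep n k (m - j) φ, ?_, by simp, fun φ ↦ ?_⟩
  · exact continuous_finsetSum _ fun j _ ↦
      ((withSeminorms_step n k).continuous_seminorm _).const_mul _
  · refine supSeminorm_le (Finset.sum_nonneg fun j _ ↦ by positivity) fun x hx ↦ ?_
    have hle : ∀ (k j : ℕ) (g : FnSpace (stepSub n k)),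
        ((1 + ‖x‖ ^ 2) ^ k)⁻¹ * ‖iteratedFDeriv ℝ j g x‖ ≤ seminormsStep n k j g := by
      intro k j g
      refine le_trans ?_ (le_supSeminorm g (Set.mem_univ x))
      rw [abs_of_nonneg (by positivity)]
    rw [abs_of_nonneg (by positivity)]
    refine (norm_step_mul_le hf.1 φ.mem.1 l k m x).trans (Finset.sum_le_sum fun j _ ↦ ?_)
    gcongr
    · exact hle l _ ⟨f, hf⟩
    · exact hle k _ φ

theorem exists_mul_OC_OC {n : ℕ} (f : SpaceOC n) :
    ∃ L : SpaceOC n →L[ℂ] SpaceOC n, ∀ φ x, L φ x = f x * φ x := by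
  obtain ⟨l, hf⟩ : ∃ l, ⇑f ∈ stepSub n l := f.mem
  let L : SpaceOC n →ₗ[ℂ] SpaceOC n :=
    FnSpace.mulLM f fun φ ⟨k, hφ⟩ ↦ ⟨l + k, mul_mem_stepSub hf hφ⟩
  -- The pullback of `p` along `L` is again one of the seminorms of `𝓞_C`: on step `k` it factors
  -- through step `l + k`.
  refine ⟨⟨L, continuous_of_seminorm_le (withSeminorms_OC n) L fun p ↦
    ⟨_, (withSeminorms_OC n).continuous_seminorm ⟨p.1.comp L, fun k ↦ ?_⟩, map_zero _,
      fun φ ↦ le_rfl⟩⟩, fun _ _ ↦ rfl⟩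
  exact (p.2 (l + k)).comp (continuous_mul_step hf k)

theorem exists_mul_S_OM {n : ℕ} (f : SpaceOM n) :
    ∃ L : 𝓢(Rn n, ℂ) →L[ℂ] 𝓢(Rn n, ℂ), ∀ φ x, L φ x = f x * φ x :=
  ⟨SchwartzMap.smulLeftCLM ℂ f, fun φ x ↦ SchwartzMap.smulLeftCLM_apply_apply f.mem φ x⟩

theorem exists_mul_D_E {n : ℕ} (f : SpaceE n) :
    ∃ L : SpaceD n →L[ℂ] SpaceD n, ∀ φ x, L φ x = f x * φ x := by
  have hf : ContDiff ℝ ∞ f := f.mem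
  refine ⟨TestFunction.limitCLM ℂ (fun φ ↦ ⟨fun x ↦ f x * φ x, hf.mul φ.contDiff,
    φ.hasCompactSupport.mul_left, fun _ _ ↦ trivial⟩)
    (fun K hK ↦ TestFunction.ofSupportedInCLM ℂ hK ∘L
      ContDiffMapSupportedIn.bilinLeftCLM (ContinuousLinearMap.mul ℂ ℂ) hf) fun K hK φ ↦ ?_,
    fun _ _ ↦ rfl⟩
  ext x
  exact mul_comm (f x) (φ x)

theorem exists_mul_E_DL {n : ℕ} (f : SpaceDL n ⊤) :
    ∃ L : SpaceD n →L[ℂ] SpaceE n, ∀ φ x, L φ x = f x * φ x := by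
  obtain ⟨L, hL⟩ := exists_mul_D_E (inclDLtoE n f)
  exact ⟨(inclDE n).comp L, hL⟩

theorem exists_mul_DLDot_DL {n : ℕ} (p : ℝ≥0∞) [hp : Fact (1 ≤ p)] (f : SpaceDL n ⊤) :
    ∃ L : SpaceDLDot n p →L[ℂ] SpaceDLDot n p, ∀ φ x, L φ x = f x * φ x := by
  have hf : ContDiff ℝ ∞ f := f.mem.1
  let a : ℕ → ℕ → ℝ := fun m j ↦ (m.choose j : ℝ) * lpSeminorm le_top (le_refl (lpSub n ⊤)) j f
  have ha : ∀ m j, 0 ≤ a m j := fun m j ↦ by positivity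
  -- This pointwise Leibniz bound with constant coefficients yields integrability, decay at infinity
  -- and continuity alike.
  have hbound : ∀ {φ : Rn n → ℂ}, ContDiff ℝ ∞ φ → ∀ m x,
      ‖iteratedFDeriv ℝ m (fun x ↦ f x * φ x) x‖ ≤
        ∑ j ∈ Finset.range (m + 1), a m j * ‖iteratedFDeriv ℝ (m - j) φ x‖ := by
    intro φ hφ m x
    refine (norm_iteratedFDeriv_mul_le_of_smooth hf hφ m x).trans ?_
    gcongr with j _
    exact mul_le_mul_of_nonneg_left (DL_top_bound f j x) (by positivity)
  have hmemLp : ∀ {φ : Rn n → ℂ}, φ ∈ lpSub n p → ∀ m j, MemLp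
      (fun x ↦ a m j * ‖iteratedFDeriv ℝ (m - j) φ x‖) p volume :=
    fun hφ m j ↦ ((hφ.2 (m - j)).norm).const_mul _
  have hmem : ∀ φ ∈ lpDotSub n p, (fun x ↦ f x * φ x) ∈ lpDotSub n p := by
    intro φ hφ
    have hs : ContDiff ℝ ∞ fun x ↦ f x * φ x := hf.mul hφ.1.1
    refine ⟨⟨hs, fun m ↦ ?_⟩, fun hpt m ↦ ?_⟩
    · refine (memLp_finsetSum (Finset.range (m + 1)) fun j _ ↦ hmemLp hφ.1 m j).mono'
        (continuous_iteratedFDeriv_of_smooth hs m).aestronglyMeasurable (.of_forall fun x ↦ ?_)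
      exact hbound hφ.1.1 m x
    · have h1 : Tendsto (fun x ↦ ∑ j ∈ Finset.range (m + 1),
          a m j * ‖iteratedFDeriv ℝ (m - j) φ x‖) (cocompact (Rn n))
          (𝓝 (∑ j ∈ Finset.range (m + 1), a m j * 0)) :=
        tendsto_finsetSum _ fun j _ ↦
          (tendsto_zero_iff_norm_tendsto_zero.1 (hφ.2 hpt (m - j))).const_mul _
      simp only [mul_zero, Finset.sum_const_zero] at h1
      exact squeeze_zero_norm (hbound hφ.1.1 m) h1
  let L : SpaceDLDot n p →ₗ[ℂ] SpaceDLDot n p := FnSpace.mulLM f hmem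
  refine ⟨⟨L, continuous_of_seminorm_le (withSeminorms_DLDot n p) L fun m ↦
    ⟨fun φ ↦ ∑ j ∈ Finset.range (m + 1), a m j *
      lpSeminorm (P := lpDotSub n p) hp.out (fun _ hf ↦ hf.1) (m - j) φ, ?_, by simp,
      fun φ ↦ ?_⟩⟩, fun _ _ ↦ rfl⟩
  · exact continuous_finsetSum _ fun j _ ↦
      ((withSeminorms_DLDot n p).continuous_seminorm (m - j)).const_mul _
  · have hφ := φ.mem.1
    have hne : ∀ j, eLpNorm (fun x ↦ a m j * ‖iteratedFDeriv ℝ (m - j) φ x‖) p volume ≠ ⊤ :=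
      fun j ↦ (hmemLp hφ m j).eLpNorm_ne_top
    have h1 : eLpNorm (iteratedFDeriv ℝ m fun x ↦ f x * φ x) p volume ≤
        ∑ j ∈ Finset.range (m + 1),
          eLpNorm (fun x ↦ a m j * ‖iteratedFDeriv ℝ (m - j) φ x‖) p volume := by
      refine (eLpNorm_mono_real (hbound hφ.1 m)).trans ?_
      have := eLpNorm_sum_le (s := Finset.range (m + 1))
        (f := fun j x ↦ a m j * ‖iteratedFDeriv ℝ (m - j) φ x‖) (p := p) (μ := volume)
        (fun j _ ↦ (hmemLp hφ m j).1) hp.out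
      refine le_trans (le_of_eq ?_) this
      congr 1
      ext x
      simp
    have h2 := ENNReal.toReal_mono (ENNReal.sum_ne_top.2 fun j _ ↦ hne j) h1
    refine h2.trans_eq ?_
    rw [ENNReal.toReal_sum fun j _ ↦ hne j]
    refine Finset.sum_congr rfl fun j _ ↦ ?_
    change _ = a m j * (eLpNorm (iteratedFDeriv ℝ (m - j) φ) p volume).toReal
    have := eLpNorm_const_smul (a m j) (fun x ↦ ‖iteratedFDeriv ℝ (m - j) φ x‖) p
      (volume : Measure (Rn n))
    change eLpNorm (fun x ↦ a m j * ‖iteratedFDeriv ℝ (m - j) φ x‖) p volume = _ at this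
    rw [this, ENNReal.toReal_mul, toReal_enorm, Real.norm_of_nonneg (ha m j), eLpNorm_norm]

/-! ### Convolution -/

namespace SchwartzMap

variable {n : ℕ}

theorem lineDerivOp_lineDerivOp_comm (v w : Rn n) (φ : 𝓢(Rn n, ℂ)) :
    ∂_{v} (∂_{w} φ) = ∂_{w} (∂_{v} φ) := by
  have key : ∀ (v w : Rn n) (x : Rn n), ∂_{v} (∂_{w} φ) x = fderiv ℝ (fderiv ℝ φ) x v w := by
    intro v w x
    rw [lineDerivOp_apply_eq_fderiv]
    have : (∂_{w} φ : 𝓢(Rn n, ℂ)) = fun y ↦ fderiv ℝ φ y w := rfl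
    have hd : DifferentiableAt ℝ (fderiv ℝ φ) x :=
      (SchwartzMap.fderivCLM ℝ (Rn n) ℂ φ).differentiableAt
    rw [this, fderiv_clm_apply hd (differentiableAt_const w)]
    simp
  ext x
  rw [key, key]
  have h : IsSymmSndFDerivAt ℝ φ x := (φ.contDiffAt 2).isSymmSndFDerivAt (by simp)
  exact h v w

theorem iteratedLineDerivOp_lineDerivOp_comm {m : ℕ} (v : Fin m → Rn n) (w : Rn n)
    (φ : 𝓢(Rn n, ℂ)) : ∂^{v} (∂_{w} φ) = ∂_{w} (∂^{v} φ) := by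
  induction m with
  | zero => rfl
  | succ m ih =>
    rw [LineDeriv.iteratedLineDerivOp_succ_left, ih, lineDerivOp_lineDerivOp_comm,
      ← LineDeriv.iteratedLineDerivOp_succ_left]

theorem differentiable_iteratedFDeriv (φ : 𝓢(Rn n, ℂ)) (m : ℕ) :
    Differentiable ℝ (iteratedFDeriv ℝ m φ) :=
  (φ.smooth ⊤).differentiable_iteratedFDeriv (mod_cast ENat.natCast_lt_top m)

/-- Symmetry of second derivatives lets `∂_w` pass through the iterated derivative. The linear
Taylor term of every derivative of φ thus comes from the one rapidly decreasing function `∂_w φ`. -/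
theorem iteratedFDeriv_lineDerivOp (φ : 𝓢(Rn n, ℂ)) (w : Rn n) (m : ℕ) (x : Rn n) :
    iteratedFDeriv ℝ m (∂_{w} φ : 𝓢(Rn n, ℂ)) x = fderiv ℝ (iteratedFDeriv ℝ m φ) x w := by
  ext v
  rw [← iteratedLineDerivOp_eq_iteratedFDeriv, iteratedLineDerivOp_lineDerivOp_comm,
    lineDerivOp_apply_eq_fderiv,
    ← fderiv_continuousMultilinear_apply_const_apply (φ.differentiable_iteratedFDeriv m x)]
  congr 2
  ext y
  exact iteratedLineDerivOp_eq_iteratedFDeriv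

/-- A Taylor estimate of second order for the derivatives of a rapidly decreasing function. -/
theorem norm_iteratedFDeriv_taylor_le (φ : 𝓢(Rn n, ℂ)) (m : ℕ) (x h : Rn n) :
    ‖iteratedFDeriv ℝ m φ (x + h) - iteratedFDeriv ℝ m φ x - iteratedFDeriv ℝ m (∂_{h} φ : 𝓢(Rn n, ℂ)) x‖ ≤
      SchwartzMap.seminorm ℂ 0 (m + 2) φ * ‖h‖ * ‖h‖ := by
  have hlip : ∀ y, ‖fderiv ℝ (iteratedFDeriv ℝ m φ) y - fderiv ℝ (iteratedFDeriv ℝ m φ) x‖ ≤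
      SchwartzMap.seminorm ℂ 0 (m + 2) φ * ‖y - x‖ := by
    intro y
    rw [fderiv_iteratedFDeriv, Function.comp_apply, Function.comp_apply, ← LinearIsometryEquiv.map_sub,
      LinearIsometryEquiv.norm_map]
    refine convex_univ.norm_image_sub_le_of_norm_fderiv_le (𝕜 := ℝ)
      (fun z _ ↦ φ.differentiable_iteratedFDeriv (m + 1) z) (fun z _ ↦ ?_) (Set.mem_univ x)
      (Set.mem_univ y)
    rw [norm_fderiv_iteratedFDeriv]
    exact φ.norm_iteratedFDeriv_le_seminorm ℂ (m + 2) z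
  -- Mean value inequality on the ball of radius `‖h‖`, where by `hlip` the derivative varies by at
  -- most a constant times `‖h‖`.
  have := (convex_closedBall x ‖h‖).norm_image_sub_le_of_norm_hasFDerivWithin_le' (𝕜 := ℝ)
    (f := iteratedFDeriv ℝ m φ) (f' := fderiv ℝ (iteratedFDeriv ℝ m φ))
    (φ := fderiv ℝ (iteratedFDeriv ℝ m φ) x) (C := SchwartzMap.seminorm ℂ 0 (m + 2) φ * ‖h‖)
    (x := x) (y := x + h)
    (fun y _ ↦ (φ.differentiable_iteratedFDeriv m y).hasFDerivAt.hasFDerivWithinAt)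
    (fun y hy ↦ (hlip y).trans (mul_le_mul_of_nonneg_left (mem_closedBall_iff_norm.1 hy)
      (apply_nonneg _ _)))
    (Metric.mem_closedBall_self (norm_nonneg h)) (by simp)
  rwa [add_sub_cancel_left, ← iteratedFDeriv_lineDerivOp] at this

theorem mem_stepSub_zero (φ : 𝓢(Rn n, ℂ)) : ⇑φ ∈ stepSub n 0 := by
  refine ⟨φ.smooth ⊤, fun m ↦ ?_⟩
  obtain ⟨C, -, hC⟩ := φ.decay 1 m
  have h1 : Tendsto (fun y : Rn n ↦ C * ‖y‖⁻¹) (cocompact (Rn n)) (𝓝 (C * 0)) :=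
    (tendsto_norm_cocompact_atTop.inv_tendsto_atTop).const_mul C
  rw [mul_zero] at h1
  refine squeeze_zero_norm' ?_ h1
  filter_upwards [tendsto_norm_cocompact_atTop.eventually_gt_atTop 0] with y hy
  rw [← div_eq_mul_inv, le_div_iff₀ hy, mul_comm]
  simpa using hC y

/-- The translate `y ↦ φ(x + y)` as an element of a step of `𝓞_C`. -/
def translateStep (k : ℕ) (φ : 𝓢(Rn n, ℂ)) (x : Rn n) : FnSpace (stepSub n k) :=
  ⟨fun y ↦ φ (x + y), by
    refine stepSub_mono n (Nat.zero_le k) ?_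
    have := (compSubConstCLM ℂ (-x) φ).mem_stepSub_zero
    convert this using 1
    ext y
    simp [add_comm]⟩

theorem one_add_norm_sq_pow_mul_le (φ : 𝓢(Rn n, ℂ)) (k : ℕ) {j N : ℕ} (hj : j ≤ N) (z : Rn n) :
    (1 + ‖z‖ ^ 2) ^ k * ‖iteratedFDeriv ℝ j φ z‖ ≤ 2 ^ (2 * k) *
      ((Finset.Iic (2 * k, N)).sup fun m ↦ SchwartzMap.seminorm ℂ m.1 m.2) φ := by
  refine le_trans ?_ (one_add_le_sup_seminorm_apply (𝕜 := ℂ) (m := (2 * k, N)) le_rfl hj φ z)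
  rw [pow_mul]
  gcongr
  nlinarith [norm_nonneg z]

/-- Peetre's inequality trades decay in x for the weight in y and the decay of φ at `x + y`. -/
theorem seminormsStep_translateStep_le (φ : 𝓢(Rn n, ℂ)) (k : ℕ) {j N : ℕ} (hj : j ≤ N) (x : Rn n) :
    (1 + ‖x‖ ^ 2) ^ k * seminormsStep n k j (translateStep k φ x) ≤ 2 ^ k * (2 ^ (2 * k) *
      ((Finset.Iic (2 * k, N)).sup fun m ↦ SchwartzMap.seminorm ℂ m.1 m.2) φ) := by
  rw [← le_div_iff₀' (by positivity)]
  refine supSeminorm_le (by positivity) fun y _ ↦ ?_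
  have h1 : iteratedFDeriv ℝ j (translateStep k φ x) y = iteratedFDeriv ℝ j φ (x + y) :=
    iteratedFDeriv_comp_add_left j x y
  have h2 : (1 + ‖x‖ ^ 2) ≤ 2 * (1 + ‖x + y‖ ^ 2) * (1 + ‖y‖ ^ 2) := by
    have h3 : ‖x‖ ≤ ‖x + y‖ + ‖y‖ := by simpa using norm_sub_le (x + y) y
    have h4 : ‖x‖ ^ 2 ≤ (‖x + y‖ + ‖y‖) ^ 2 := by gcongr
    nlinarith [sq_nonneg (‖x + y‖ - ‖y‖), mul_nonneg (sq_nonneg ‖x + y‖) (sq_nonneg ‖y‖)]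
  rw [h1, abs_of_nonneg (by positivity), le_div_iff₀' (by positivity)]
  calc (1 + ‖x‖ ^ 2) ^ k * (((1 + ‖y‖ ^ 2) ^ k)⁻¹ * ‖iteratedFDeriv ℝ j φ (x + y)‖)
      ≤ (2 * (1 + ‖x + y‖ ^ 2) * (1 + ‖y‖ ^ 2)) ^ k *
        (((1 + ‖y‖ ^ 2) ^ k)⁻¹ * ‖iteratedFDeriv ℝ j φ (x + y)‖) := by gcongr
    _ = 2 ^ k * ((1 + ‖x + y‖ ^ 2) ^ k * ‖iteratedFDeriv ℝ j φ (x + y)‖) := by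
      rw [mul_pow, mul_pow]
      field_simp
    _ ≤ _ := mul_le_mul_of_nonneg_left (one_add_norm_sq_pow_mul_le φ k hj (x + y)) (by positivity)

end SchwartzMap

section Convolution

variable {n : ℕ} (T : DualOC n)

/-- Continuity of `T` on step `k` involves finitely many seminorms; `a` is a common bound for them.
-/
theorem exists_bound_comp_stepToOC (k : ℕ) : ∃ C : ℝ, ∃ N : ℕ, 0 ≤ C ∧
    ∀ (g : FnSpace (stepSub n k)) (a : ℝ), 0 ≤ a → (∀ j ≤ N, seminormsStep n k j g ≤ a) →
      ‖T (stepToOC n k g)‖ ≤ C * a := by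
  let L : FnSpace (stepSub n k) →ₗ[ℂ] ℂ := T.toLinearMap ∘ₗ stepToOCₗ n k
  have hL : Continuous ((normSeminorm ℂ ℂ).comp L) :=
    continuous_norm.comp (T.continuous.comp (continuous_stepToOC n k))
  obtain ⟨s, C, -, hle⟩ := Seminorm.bound_of_continuous (withSeminorms_step n k) _ hL
  obtain ⟨N, hN⟩ := s.bddAbove
  refine ⟨C, N, C.2, fun g a ha h ↦ (hle g).trans ?_⟩
  change (C : ℝ) * (s.sup (seminormsStep n k)) g ≤ _
  gcongr
  exact Seminorm.finset_sup_apply_le ha fun j hj ↦ h j (hN hj)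

/-- The function `x ↦ ⟨φ(x + y), T_y⟩`. -/
def convFun (φ : 𝓢(Rn n, ℂ)) (x : Rn n) : ℂ := T (translateOC φ x)

theorem convFun_add (φ χ : 𝓢(Rn n, ℂ)) : convFun T (φ + χ) = convFun T φ + convFun T χ :=
  funext fun x ↦ map_add T (translateOC φ x) (translateOC χ x)

theorem convFun_smul (c : ℂ) (φ : 𝓢(Rn n, ℂ)) : convFun T (c • φ) = c • convFun T φ :=
  funext fun x ↦ map_smul T c (translateOC φ x)

theorem convFun_sub (φ χ : 𝓢(Rn n, ℂ)) : convFun T (φ - χ) = convFun T φ - convFun T χ :=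
  funext fun x ↦ map_sub T (translateOC φ x) (translateOC χ x)

theorem convFun_compSubConst (φ : 𝓢(Rn n, ℂ)) (x h : Rn n) :
    convFun T (SchwartzMap.compSubConstCLM ℂ (-h) φ) x = convFun T φ (x + h) := by
  refine congrArg T (DFunLike.ext _ _ fun y ↦ ?_)
  change SchwartzMap.compSubConstCLM ℂ (-h) φ (x + y) = φ (x + h + y)
  rw [SchwartzMap.compSubConstCLM_apply]
  congr 1
  abel

/-- `T` is continuous on every step and translates of φ lie in all of them, so `k` is arbitrary:
this is the rapid decay. -/
theorem exists_convFun_bound (k : ℕ) : ∃ r : 𝓢(Rn n, ℂ) → ℝ, Continuous r ∧ r 0 = 0 ∧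
    ∀ φ x, (1 + ‖x‖ ^ 2) ^ k * ‖convFun T φ x‖ ≤ r φ := by
  obtain ⟨C, N, hC, h⟩ := exists_bound_comp_stepToOC T k
  refine ⟨fun φ ↦ C * (2 ^ k * (2 ^ (2 * k) *
    ((Finset.Iic (2 * k, N)).sup fun m ↦ SchwartzMap.seminorm ℂ m.1 m.2) φ)), ?_, by simp,
    fun φ x ↦ ?_⟩
  · exact (((((schwartz_withSeminorms ℂ (Rn n) ℂ).finset_sups).continuous_seminorm
      (Finset.Iic (2 * k, N))).const_mul _).const_mul _).const_mul _
  · have hp : (0 : ℝ) < (1 + ‖x‖ ^ 2) ^ k := by positivity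
    have := h (φ.translateStep k x) (2 ^ k * (2 ^ (2 * k) *
      ((Finset.Iic (2 * k, N)).sup fun m ↦ SchwartzMap.seminorm ℂ m.1 m.2) φ) /
        (1 + ‖x‖ ^ 2) ^ k) (by positivity) fun j hj ↦ by
      rw [le_div_iff₀' hp]
      exact φ.seminormsStep_translateStep_le k hj x
    rw [← mul_div_assoc, le_div_iff₀' hp] at this
    exact this

theorem exists_convFun_bound_of_le : ∃ C : ℝ, ∃ N : ℕ, 0 ≤ C ∧ ∀ (φ : 𝓢(Rn n, ℂ)) (a : ℝ), 0 ≤ a →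
    (∀ j ≤ N, ∀ z, ‖iteratedFDeriv ℝ j φ z‖ ≤ a) → ∀ x, ‖convFun T φ x‖ ≤ C * a := by
  obtain ⟨C, N, hC, h⟩ := exists_bound_comp_stepToOC T 0
  refine ⟨C, N, hC, fun φ a ha hφ x ↦ h (φ.translateStep 0 x) a ha fun j hj ↦
    supSeminorm_le ha fun y _ ↦ ?_⟩
  have h1 : iteratedFDeriv ℝ j (φ.translateStep 0 x) y = iteratedFDeriv ℝ j φ (x + y) :=
    iteratedFDeriv_comp_add_left j x y
  rw [h1]
  simpa using hφ j hj (x + y)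

/-- The left side is `convFun T` of `φ(· + h) - φ - ∂_h φ`, whose derivatives of order at most `N`
are uniformly `O(|h|²)`; step 0 suffices because no decay is needed. -/
theorem exists_convFun_taylor (φ : 𝓢(Rn n, ℂ)) : ∃ C : ℝ, ∀ x h : Rn n,
    ‖convFun T φ (x + h) - convFun T φ x - convFun T (∂_{h} φ) x‖ ≤ C * ‖h‖ ^ 2 := by
  obtain ⟨C, N, hC, hb⟩ := exists_convFun_bound_of_le T
  set M := ∑ j ∈ Finset.range (N + 1), SchwartzMap.seminorm ℂ 0 (j + 2) φ with hM
  have hM0 : 0 ≤ M := Finset.sum_nonneg fun j _ ↦ apply_nonneg _ _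
  refine ⟨C * M, fun x h ↦ ?_⟩
  have := hb (SchwartzMap.compSubConstCLM ℂ (-h) φ - φ - ∂_{h} φ) (M * ‖h‖ ^ 2) (by positivity)
    (fun j hj z ↦ ?_) x
  · rw [convFun_sub, convFun_sub, Pi.sub_apply, Pi.sub_apply, convFun_compSubConst, ← mul_assoc]
      at this
    exact this
  · have hs : ∀ χ : 𝓢(Rn n, ℂ), ContDiff ℝ j χ := fun χ ↦ χ.smooth j
    have h1 : iteratedFDeriv ℝ j (SchwartzMap.compSubConstCLM ℂ (-h) φ - φ - ∂_{h} φ :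
        𝓢(Rn n, ℂ)) z = iteratedFDeriv ℝ j φ (z + h) - iteratedFDeriv ℝ j φ z -
          iteratedFDeriv ℝ j (∂_{h} φ : 𝓢(Rn n, ℂ)) z := by
      have h2 : ⇑(SchwartzMap.compSubConstCLM ℂ (-h) φ - φ - ∂_{h} φ : 𝓢(Rn n, ℂ)) =
        (fun y ↦ φ (y + h)) - ⇑φ - ⇑(∂_{h} φ : 𝓢(Rn n, ℂ)) := by
        ext y
        simp
      have hs' : ContDiff ℝ j fun y ↦ φ (y + h) := (hs φ).comp (contDiff_id.add contDiff_const)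
      have hs'' : ContDiff ℝ j ((fun y ↦ φ (y + h)) - ⇑φ) := hs'.sub (hs φ)
      rw [h2, iteratedFDeriv_sub_apply hs''.contDiffAt (hs _).contDiffAt,
        iteratedFDeriv_sub_apply hs'.contDiffAt (hs φ).contDiffAt, iteratedFDeriv_comp_add_right]
    rw [h1, sq, ← mul_assoc]
    refine (φ.norm_iteratedFDeriv_taylor_le j z h).trans ?_
    gcongr
    exact Finset.single_le_sum (f := fun j ↦ SchwartzMap.seminorm ℂ 0 (j + 2) φ)
      (fun i _ ↦ apply_nonneg _ _) (Finset.mem_range_succ_iff.2 hj)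

/-- `c ↦ (v ↦ v_i c)`. -/
def coordSMul (n : ℕ) (i : Fin n) : ℂ →L[ℝ] Rn n →L[ℝ] ℂ :=
  ContinuousLinearMap.smulRightL ℝ (Rn n) ℂ (EuclideanSpace.proj i)

/-- Expresses the candidate derivative `h ↦ convFun T (∂_h φ) x` through finitely many fixed
functions, which shows that it is linear in h. -/
theorem lineDerivOp_eq_sum (φ : 𝓢(Rn n, ℂ)) (h : Rn n) :
    (∂_{h} φ : 𝓢(Rn n, ℂ)) = ∑ i, ((h i : ℝ) : ℂ) • ∂_{EuclideanSpace.single i (1 : ℝ)} φ := by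
  ext x
  have h1 : h = ∑ i, h i • EuclideanSpace.single i (1 : ℝ) := by
    ext j
    simp [Pi.single_apply]
  have h2 : (∑ i, ((h i : ℝ) : ℂ) • ∂_{EuclideanSpace.single i (1 : ℝ)} φ : 𝓢(Rn n, ℂ)) x =
      ∑ i, ((h i : ℝ) : ℂ) • fderiv ℝ φ x (EuclideanSpace.single i (1 : ℝ)) := by
    simp [SchwartzMap.lineDerivOp_apply_eq_fderiv]
  rw [h2, SchwartzMap.lineDerivOp_apply_eq_fderiv]
  conv_lhs => rw [h1, map_sum]
  simp

theorem hasFDerivAt_convFun (φ : 𝓢(Rn n, ℂ)) (x : Rn n) :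
    HasFDerivAt (convFun T φ)
      (∑ i, coordSMul n i (convFun T (∂_{EuclideanSpace.single i (1 : ℝ)} φ) x)) x := by
  obtain ⟨C, hC⟩ := exists_convFun_taylor T φ
  rw [hasFDerivAt_iff_isLittleO_nhds_zero]
  have hlin : ∀ h : Rn n, (∑ i, coordSMul n i (convFun T
      (∂_{EuclideanSpace.single i (1 : ℝ)} φ) x)) h = convFun T (∂_{h} φ) x := by
    intro h
    have hsum : ∀ (s : Finset (Fin n)) (χ : Fin n → 𝓢(Rn n, ℂ)),
        convFun T (∑ i ∈ s, χ i) = ∑ i ∈ s, convFun T (χ i) := fun s χ ↦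
      map_sum (⟨⟨convFun T, convFun_add T⟩, convFun_smul T⟩ : 𝓢(Rn n, ℂ) →ₗ[ℂ] (Rn n → ℂ)) χ s
    rw [lineDerivOp_eq_sum, hsum, Finset.sum_apply, sum_apply]
    refine Finset.sum_congr rfl fun i _ ↦ ?_
    rw [convFun_smul]
    simp [coordSMul]
  simp only [hlin]
  refine (Asymptotics.IsBigO.of_bound C (.of_forall fun h ↦ ?_)).trans_isLittleO
    (g := fun h : Rn n ↦ ‖h‖ ^ 2) ?_
  · simpa using hC x h
  · exact Asymptotics.isLittleO_norm_pow_id one_lt_two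

theorem fderiv_convFun (φ : 𝓢(Rn n, ℂ)) : fderiv ℝ (convFun T φ) = fun x ↦
    ∑ i, coordSMul n i (convFun T (∂_{EuclideanSpace.single i (1 : ℝ)} φ) x) :=
  funext fun x ↦ (hasFDerivAt_convFun T φ x).fderiv

/-- The derivative is built from functions `convFun T (∂_i φ)` of the same kind, so induction over
all φ applies. -/
theorem contDiff_convFun (φ : 𝓢(Rn n, ℂ)) : ContDiff ℝ ∞ (convFun T φ) := by
  rw [contDiff_infty]
  intro m
  induction m generalizing φ with
  | zero =>
    exact contDiff_zero.2 (continuous_iff_continuousAt.2 fun x ↦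
      (hasFDerivAt_convFun T φ x).continuousAt)
  | succ m ih =>
    exact contDiff_succ_iff_hasFDerivAt.2 ⟨_, ContDiff.sum fun i _ ↦
      (coordSMul n i).contDiff.comp (ih _), hasFDerivAt_convFun T φ⟩

theorem norm_iteratedFDeriv_sum_le {E F ι : Type*} [NormedAddCommGroup E] [NormedSpace ℝ E]
    [NormedAddCommGroup F] [NormedSpace ℝ F] {s : Finset ι} {f : ι → E → F} {m : ℕ} {x : E}
    (hf : ∀ i ∈ s, ContDiff ℝ m (f i)) :
    ‖iteratedFDeriv ℝ m (fun y ↦ ∑ i ∈ s, f i y) x‖ ≤ ∑ i ∈ s, ‖iteratedFDeriv ℝ m (f i) x‖ := by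
  rw [iteratedFDeriv_sum hf, Finset.sum_apply]
  exact norm_sum_le _ _

theorem exists_iteratedFDeriv_convFun_bound (m k : ℕ) :
    ∃ r : 𝓢(Rn n, ℂ) → ℝ, Continuous r ∧ r 0 = 0 ∧
      ∀ φ x, (1 + ‖x‖ ^ 2) ^ k * ‖iteratedFDeriv ℝ m (convFun T φ) x‖ ≤ r φ := by
  induction m with
  | zero => simpa using exists_convFun_bound T k
  | succ m ih =>
    obtain ⟨r, hr, hr0, hle⟩ := ih
    refine ⟨fun φ ↦ ∑ i, ‖coordSMul n i‖ * r (∂_{EuclideanSpace.single i (1 : ℝ)} φ), ?_, ?_,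
      fun φ x ↦ ?_⟩
    · exact continuous_finsetSum _ fun i _ ↦
        (hr.comp (ContinuousLineDeriv.continuous_lineDerivOp _)).const_mul _
    · refine Finset.sum_eq_zero fun i _ ↦ ?_
      have : (∂_{EuclideanSpace.single i (1 : ℝ)} (0 : 𝓢(Rn n, ℂ)) : 𝓢(Rn n, ℂ)) = 0 :=
        map_zero (LineDeriv.lineDerivOpCLM ℂ 𝓢(Rn n, ℂ) (EuclideanSpace.single i (1 : ℝ)))
      rw [this, hr0, mul_zero]
    · rw [← norm_iteratedFDeriv_fderiv, fderiv_convFun]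
      have hs : ∀ i, ContDiff ℝ ∞ fun x ↦
          coordSMul n i (convFun T (∂_{EuclideanSpace.single i (1 : ℝ)} φ) x) :=
        fun i ↦ (coordSMul n i).contDiff.comp (contDiff_convFun T _)
      refine (mul_le_mul_of_nonneg_left (norm_iteratedFDeriv_sum_le fun i _ ↦
        (hs i).of_le (mod_cast le_top)) (by positivity)).trans ?_
      rw [Finset.mul_sum]
      refine Finset.sum_le_sum fun i _ ↦ ?_
      have h1 := (coordSMul n i).norm_iteratedFDeriv_comp_left (n := m) (x := x)
        (contDiff_convFun T (∂_{EuclideanSpace.single i (1 : ℝ)} φ)).contDiffAt (mod_cast le_top)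
      refine (mul_le_mul_of_nonneg_left h1 (by positivity)).trans ?_
      rw [mul_left_comm]
      exact mul_le_mul_of_nonneg_left (hle _ x) (norm_nonneg _)

theorem norm_pow_le_one_add_norm_sq_pow (x : Rn n) (k : ℕ) : ‖x‖ ^ k ≤ (1 + ‖x‖ ^ 2) ^ k := by
  gcongr
  nlinarith [sq_nonneg (‖x‖ - 1), norm_nonneg x]

/-- For `T ∈ 𝓞_C'`, the operator `φ ↦ (x ↦ ⟨φ(x + y), T_y⟩)` on `𝓢`. -/
def convSchwartz : 𝓢(Rn n, ℂ) →ₗ[ℂ] 𝓢(Rn n, ℂ) where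
  toFun φ := ⟨convFun T φ, contDiff_convFun T φ, fun k m ↦ by
    obtain ⟨r, -, -, h⟩ := exists_iteratedFDeriv_convFun_bound T m k
    exact ⟨r φ, fun x ↦ (mul_le_mul_of_nonneg_right (norm_pow_le_one_add_norm_sq_pow x k)
      (norm_nonneg _)).trans (h φ x)⟩⟩
  map_add' φ χ := DFunLike.coe_injective (convFun_add T φ χ)
  map_smul' c φ := DFunLike.coe_injective (convFun_smul T c φ)

theorem continuous_convSchwartz : Continuous (convSchwartz T) := by
  refine continuous_of_seminorm_le (schwartz_withSeminorms ℂ (Rn n) ℂ) _ fun i ↦ ?_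
  obtain ⟨r, hr, hr0, h⟩ := exists_iteratedFDeriv_convFun_bound T i.2 i.1
  refine ⟨r, hr, hr0, fun φ ↦ SchwartzMap.seminorm_le_bound ℂ i.1 i.2 _ ?_ fun x ↦ ?_⟩
  · exact (by positivity : (0 : ℝ) ≤ _).trans (h φ 0)
  · exact (mul_le_mul_of_nonneg_right (norm_pow_le_one_add_norm_sq_pow x i.1)
      (norm_nonneg _)).trans (h φ x)

end Convolution

theorem exists_isConvolution (n : ℕ) : ∃ c : DualS n → DualOC n → DualS n, IsConvolution n c :=
  ⟨fun S T ↦ S.comp ⟨convSchwartz T, continuous_convSchwartz T⟩,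
    fun _ T φ ↦ ⟨convSchwartz T φ, fun _ ↦ rfl, rfl⟩⟩

/-! ### Bounded subsets of `𝓞_C` and point masses -/

section SequenceSeminorm

variable {n : ℕ}

theorem norm_stepToOC_le (l : ℕ) (f : FnSpace (stepSub n l)) (x : Rn n) :
    ‖stepToOC n l f x‖ ≤ (1 + ‖x‖ ^ 2) ^ l * seminormsStep n l 0 f := by
  have hp : (0 : ℝ) < (1 + ‖x‖ ^ 2) ^ l := by positivity
  have h : |((1 + ‖x‖ ^ 2) ^ l)⁻¹| * ‖iteratedFDeriv ℝ 0 f x‖ ≤ seminormsStep n l 0 f := by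
    refine le_trans ?_ (le_supSeminorm f (Set.mem_univ x))
    exact le_rfl
  rw [abs_of_nonneg (by positivity), inv_mul_le_iff₀ hp, norm_iteratedFDeriv_zero] at h
  exact h

/-- For `k ≥ l` the weight beats the growth allowed in step `l`; the finitely many `k < l` are
covered by the sum. No condition on the points is needed. -/
theorem weighted_value_le (x : ℕ → Rn n) (l : ℕ) (f : FnSpace (stepSub n l)) (k : ℕ) :
    ((1 + ‖x k‖ ^ 2) ^ k)⁻¹ * ‖stepToOC n l f (x k)‖ ≤
      (1 + ∑ j ∈ Finset.range l, (1 + ‖x j‖ ^ 2) ^ l) * seminormsStep n l 0 f := by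
  have h1 : (1 : ℝ) ≤ 1 + ‖x k‖ ^ 2 := le_add_of_nonneg_right (by positivity)
  have hp : (0 : ℝ) < (1 + ‖x k‖ ^ 2) ^ k := by positivity
  refine (mul_le_mul_of_nonneg_left (norm_stepToOC_le l f (x k)) (by positivity)).trans ?_
  rw [← mul_assoc]
  refine mul_le_mul_of_nonneg_right ?_ (apply_nonneg _ _)
  have hs : 0 ≤ ∑ j ∈ Finset.range l, (1 + ‖x j‖ ^ 2) ^ l :=
    Finset.sum_nonneg fun j _ ↦ by positivity
  rcases le_or_gt l k with hlk | hlk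
  · refine le_trans ?_ (le_add_of_nonneg_right hs)
    rw [inv_mul_le_iff₀ hp, mul_one]
    exact pow_le_pow_right₀ h1 hlk
  · refine le_trans ?_ (le_add_of_nonneg_left zero_le_one)
    refine le_trans ?_ (Finset.single_le_sum (f := fun j ↦ (1 + ‖x j‖ ^ 2) ^ l)
      (fun j _ ↦ by positivity) (Finset.mem_range.2 hlk))
    exact mul_le_of_le_one_left (by positivity) (one_add_norm_sq_pow_inv_le_one (x k) k)

theorem bddAbove_weighted_values (x : ℕ → Rn n) (f : SpaceOC n) :
    BddAbove (Set.range fun k ↦ ((1 + ‖x k‖ ^ 2) ^ k)⁻¹ * ‖f (x k)‖) := by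
  obtain ⟨l, hf⟩ : ∃ l, ⇑f ∈ stepSub n l := f.mem
  refine ⟨(1 + ∑ j ∈ Finset.range l, (1 + ‖x j‖ ^ 2) ^ l) * seminormsStep n l 0 ⟨f, hf⟩, ?_⟩
  rintro _ ⟨k, rfl⟩
  exact weighted_value_le x l ⟨f, hf⟩ k

/-- The seminorm `f ↦ sup_k (1 + |x_k|²)^{-k} |f(x_k)|` for a sequence of points `x_k`. -/
def sequenceSeminorm (x : ℕ → Rn n) : Seminorm ℂ (SpaceOC n) :=
  Seminorm.of (fun f ↦ ⨆ k, ((1 + ‖x k‖ ^ 2) ^ k)⁻¹ * ‖f (x k)‖)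
    (fun f g ↦ by
      have h0 : ∀ h : SpaceOC n, 0 ≤ ⨆ k, ((1 + ‖x k‖ ^ 2) ^ k)⁻¹ * ‖h (x k)‖ :=
        fun h ↦ Real.iSup_nonneg fun k ↦ by positivity
      refine Real.iSup_le (fun k ↦ ?_) (add_nonneg (h0 f) (h0 g))
      refine le_trans ?_ (add_le_add (le_ciSup (bddAbove_weighted_values x f) k)
        (le_ciSup (bddAbove_weighted_values x g) k))
      rw [← mul_add]
      exact mul_le_mul_of_nonneg_left (norm_add_le (f (x k)) (g (x k))) (by positivity))
    (fun c f ↦ by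
      rw [Real.mul_iSup_of_nonneg (norm_nonneg c)]
      congr 1
      ext1 k
      change _ * ‖c * f (x k)‖ = _
      rw [norm_mul]
      ring)

theorem continuous_sequenceSeminorm (x : ℕ → Rn n) : Continuous (sequenceSeminorm x) := by
  refine (withSeminorms_OC n).continuous_seminorm ⟨sequenceSeminorm x, fun l ↦ ?_⟩
  have hc : Continuous fun f ↦ (1 + ∑ j ∈ Finset.range l, (1 + ‖x j‖ ^ 2) ^ l) *
      seminormsStep n l 0 f := ((withSeminorms_step n l).continuous_seminorm 0).const_mul _
  refine Seminorm.continuous_of_continuousAt_zero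
    (p := (sequenceSeminorm x).comp (stepToOCₗ n l)) ?_
  rw [ContinuousAt, map_zero]
  refine squeeze_zero (fun f ↦ apply_nonneg _ _) (fun f ↦ ?_) (hc.tendsto' 0 0 (by simp))
  exact Real.iSup_le (weighted_value_le x l f) (by positivity)

/-- The functions in a bounded subset of `𝓞_C` satisfy a common polynomial bound. -/
theorem exists_polynomial_bound_of_isVonNBounded {B : Set (SpaceOC n)}
    (hB : Bornology.IsVonNBounded ℂ B) :
    ∃ k : ℕ, ∀ g ∈ B, ∀ x, ‖g x‖ ≤ k * (1 + ‖x‖ ^ 2) ^ k := by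
  -- Otherwise each `k` gives `g k ∈ B` and `x k` violating the bound with `k` as both constant and
  -- exponent; the seminorm of this sequence exceeds `k` at `g k`, yet it is continuous and so
  -- bounded on `B`.
  by_contra! h
  choose g hg x hx using h
  obtain ⟨r, -, hr⟩ := ((withSeminorms_OC n).isVonNBounded_iff_seminorm_bounded.1 hB)
    ⟨sequenceSeminorm x, fun l ↦
      (continuous_sequenceSeminorm x).comp (continuous_stepToOC n l)⟩
  obtain ⟨k, hk⟩ := exists_nat_ge r
  have h1 : ((1 + ‖x k‖ ^ 2) ^ k)⁻¹ * ‖g k (x k)‖ ≤ sequenceSeminorm x (g k) :=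
    le_ciSup (bddAbove_weighted_values x (g k)) k
  have h2 : (k : ℝ) < ((1 + ‖x k‖ ^ 2) ^ k)⁻¹ * ‖g k (x k)‖ := by
    rw [lt_inv_mul_iff₀ (by positivity), mul_comm]
    exact hx k
  exact absurd (hr (g k) (hg k)) (not_lt.2 (hk.trans (h2.le.trans h1)))

/-- The Dirac measure at `x`. -/
def diracOC (x : Rn n) : DualOC n where
  toFun f := f x
  map_add' _ _ := rfl
  map_smul' _ _ := rfl
  cont := by
    let L : SpaceOC n →ₗ[ℂ] ℂ := ⟨⟨fun f ↦ f x, fun _ _ ↦ rfl⟩, fun _ _ ↦ rfl⟩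
    refine continuous_of_seminorm_le (norm_withSeminorms ℂ ℂ) L fun _ ↦
      ⟨sequenceSeminorm fun _ ↦ x, continuous_sequenceSeminorm _, map_zero _, fun f ↦ ?_⟩
    have h : ((1 + ‖x‖ ^ 2) ^ 0)⁻¹ * ‖f x‖ ≤ sequenceSeminorm (fun _ ↦ x) f :=
      le_ciSup (bddAbove_weighted_values (fun _ ↦ x) f) 0
    rwa [pow_zero, inv_one, one_mul] at h

end SequenceSeminorm

/-- Every neighbourhood of `0` in `𝓞_C'` contains Dirac measures with masses which decrease
at most polynomially. -/
theorem exists_dirac_mem_nhds {n : ℕ} {V : Set (DualOC n)} (hV : V ∈ 𝓝 0) :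
    ∃ (k : ℕ) (δ : ℝ), 0 < δ ∧ ∀ x : Rn n,
      ((δ * ((1 + ‖x‖ ^ 2) ^ k)⁻¹ : ℝ) : ℂ) • diracOC x ∈ V := by
  obtain ⟨⟨B, W⟩, ⟨hB, hW⟩, hBW⟩ := ContinuousLinearMap.hasBasis_nhds_zero.mem_iff.1 hV
  obtain ⟨ε, hε, hεW⟩ := Metric.mem_nhds_iff.1 hW
  obtain ⟨k, hk⟩ := exists_polynomial_bound_of_isVonNBounded hB
  -- Dividing by `k + 1` instead of `k` gives the strict bound `ε k/(k + 1) < ε`, also for `k = 0`.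
  refine ⟨k, ε / (k + 1), by positivity, fun x ↦ hBW fun g hg ↦ hεW ?_⟩
  rw [mem_ball_zero_iff]
  change ‖((ε / (k + 1) * ((1 + ‖x‖ ^ 2) ^ k)⁻¹ : ℝ) : ℂ) * g x‖ < ε
  rw [norm_mul, Complex.norm_real, Real.norm_of_nonneg (by positivity)]
  have hp : (0 : ℝ) < (1 + ‖x‖ ^ 2) ^ k := by positivity
  calc ε / (k + 1) * ((1 + ‖x‖ ^ 2) ^ k)⁻¹ * ‖g x‖
      ≤ ε / (k + 1) * ((1 + ‖x‖ ^ 2) ^ k)⁻¹ * (k * (1 + ‖x‖ ^ 2) ^ k) := by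
        gcongr
        exact hk g hg x
    _ = ε * (k / (k + 1)) := by field_simp
    _ < ε := mul_lt_of_lt_one_right hε ((div_lt_one (by positivity)).2 (lt_add_one _))

/-! ### Discontinuity of the convolution and of the multiplications -/

theorem not_continuous_of_isConvolution {n : ℕ} (hn : 1 ≤ n) (c : DualS n → DualOC n → DualS n)
    (hc : IsConvolution n c) : ¬ Continuous (Function.uncurry c) := by
  intro hcont
  obtain ⟨φ, hφ⟩ := exists_schwartz_cutoff n
  have hs : ∀ (z : ℂ) S T, c (z • S) T φ = z * c S T φ := by
    intro z S T
    obtain ⟨ψ, h1, h2⟩ := hc (z • S) T φ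
    obtain ⟨χ, h3, h4⟩ := hc S T φ
    have : ψ = χ := DFunLike.ext _ _ fun x ↦ (h1 x).trans (h3 x).symm
    rw [h2, h4, this]
    rfl
  obtain ⟨V, hV, hbd⟩ := exists_nhds_forall_bounded c hcont φ hs
  obtain ⟨k, δ, hδ, hdirac⟩ := exists_dirac_mem_nhds hV
  let x : ℕ → Rn n := fun t ↦ EuclideanSpace.single ⟨0, hn⟩ (t + 1 : ℝ)
  have hx : ∀ t, ‖x t‖ = t + 1 := fun t ↦ by
    rw [PiLp.norm_single, Real.norm_of_nonneg (by positivity)]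
  choose ψ hψ hcψ using fun (S : DualS n) (t : ℕ) ↦
    hc S (((δ * ((1 + ‖x t‖ ^ 2) ^ k)⁻¹ : ℝ) : ℂ) • diracOC (x t)) φ
  have hψ0 : ∀ S t, ψ S t = ψ 0 t :=
    fun S t ↦ DFunLike.ext _ _ fun y ↦ (hψ S t y).trans (hψ 0 t y).symm
  -- The masses shrink like `|x|^{-2k}`; the weight `|x|^{2k+1}` has one power more and still makes
  -- the translates unbounded.
  obtain ⟨C, hC⟩ := (SchwartzMap.seminorm ℂ (2 * k + 1) 0).exists_bound_of_forall_strongDual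
    ((schwartz_withSeminorms ℂ (Rn n) ℂ).continuous_seminorm (2 * k + 1, 0)) (ψ 0) fun S ↦ by
      obtain ⟨C, hC⟩ := hbd S
      refine ⟨C, fun t ↦ ?_⟩
      rw [← hψ0 S t, ← hcψ]
      exact hC _ (hdirac (x t))
  obtain ⟨t, ht⟩ := exists_nat_gt (C / (δ / 2 ^ k))
  have hδk : 0 < δ / 2 ^ k := by positivity
  rw [div_lt_iff₀ hδk] at ht
  have ht1 : (1 : ℝ) ≤ t + 1 := le_add_of_nonneg_left t.cast_nonneg
  -- Convolving with the point mass at `x t` shifts φ so that the value `φ(0) = 1` appears at `-x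
  -- t`.
  have hval : ψ 0 t (-x t) = ((δ * ((1 + ‖x t‖ ^ 2) ^ k)⁻¹ : ℝ) : ℂ) := by
    rw [hψ]
    change _ * φ (-x t + x t) = _
    rw [neg_add_cancel, hφ 0 (Metric.mem_ball_self one_pos), mul_one]
  have h1 := (ψ 0 t).norm_pow_mul_le_seminorm ℂ (2 * k + 1) (-x t)
  rw [hval, norm_neg, Complex.norm_real, Real.norm_of_nonneg (by positivity), hx] at h1
  have h2 : (t + 1) * (δ / 2 ^ k) ≤ (t + 1 : ℝ) ^ (2 * k + 1) * (δ * ((1 + (t + 1 : ℝ) ^ 2) ^ k)⁻¹) := by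
    have h3 : (1 + (t + 1 : ℝ) ^ 2) ^ k ≤ 2 ^ k * (t + 1) ^ (2 * k) := by
      rw [pow_mul, ← mul_pow]
      gcongr
      nlinarith
    have h4 : (0 : ℝ) < (1 + (t + 1 : ℝ) ^ 2) ^ k := by positivity
    rw [← div_eq_mul_inv, ← mul_div_assoc, ← mul_div_assoc, div_le_div_iff₀ (by positivity) h4]
    calc (t + 1) * δ * (1 + (t + 1 : ℝ) ^ 2) ^ k ≤ (t + 1) * δ * (2 ^ k * (t + 1) ^ (2 * k)) := by
          gcongr
      _ = (t + 1) ^ (2 * k + 1) * δ * 2 ^ k := by ring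
  have h5 := (h2.trans h1).trans (hC t)
  nlinarith

theorem exists_discontinuous_multiplication {n : ℕ} (hn : 1 ≤ n) {X M Y : Type} [AddCommGroup X]
    [Module ℂ X] [TopologicalSpace X] [IsTopologicalAddGroup X] [FunLike X (Rn n) ℂ]
    [TopologicalSpace M] [Zero M] [FunLike M (Rn n) ℂ] [AddCommGroup Y] [Module ℂ Y]
    [TopologicalSpace Y] [ContinuousSMul ℂ Y] [FunLike Y (Rn n) ℂ]
    (h : ∀ f : M, ∃ L : Y →L[ℂ] X, ∀ φ x, L φ x = f x * φ x)
    (hX : ControlsDerivatives n X) (ι : SpaceDL n ⊤ → M) (hι : Continuous ι) (hι0 : ι 0 = 0)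
    (hιf : ∀ f x, ι f x = f x)
    (hY : ∃ φ : Y, ∀ x ∈ Metric.ball (0 : Rn n) 1, φ x = 1) :
    ∃ b : StrongDual ℂ X → M → StrongDual ℂ Y,
      IsMultiplication n b ∧ ¬ Continuous (Function.uncurry b) := by
  obtain ⟨b, hb⟩ := exists_isMultiplication h
  exact ⟨b, hb, not_continuous_of_isMultiplication hn hX ι hι hι0 hιf hY b hb⟩

end

theorem proposition6 (n : ℕ) (hn : 1 ≤ n) :
    -- multiplication `𝓔' × 𝓔 → 𝓔'`
    (∃ b : DualE n → SpaceE n → DualE n,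
      IsMultiplication n b ∧ ¬ Continuous (Function.uncurry b)) ∧
    -- multiplication `𝓞_M' × 𝓞_M → 𝓞_M'`
    (∃ b : DualOM n → SpaceOM n → DualOM n,
      IsMultiplication n b ∧ ¬ Continuous (Function.uncurry b)) ∧
    -- multiplication `𝓞_C' × 𝓞_C → 𝓞_C'`
    (∃ b : DualOC n → SpaceOC n → DualOC n,
      IsMultiplication n b ∧ ¬ Continuous (Function.uncurry b)) ∧
    -- multiplication `𝓓'_{L^q} × 𝓓_{L^∞} → 𝓓'_{L^q}`
    (∀ q : ℝ≥0∞, 1 ≤ q → ∃ b : DualDL n q → SpaceDL n ⊤ → DualDL n q,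
      IsMultiplication n b ∧ ¬ Continuous (Function.uncurry b)) ∧
    -- multiplication `𝓢' × 𝓞_M → 𝓢'`
    (∃ b : DualS n → SpaceOM n → DualS n,
      IsMultiplication n b ∧ ¬ Continuous (Function.uncurry b)) ∧
    -- multiplication `𝓓' × 𝓔 → 𝓓'`
    (∃ b : DualD n → SpaceE n → DualD n,
      IsMultiplication n b ∧ ¬ Continuous (Function.uncurry b)) ∧
    -- convolution `𝓢' × 𝓞_C' → 𝓢'`
    (∃ c : DualS n → DualOC n → DualS n,
      IsConvolution n c ∧ ¬ Continuous (Function.uncurry c)) ∧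
    -- multiplication `𝓔' × 𝓓_{L^∞} → 𝓓'`
    (∃ b : DualE n → SpaceDL n ⊤ → DualD n,
      IsMultiplication n b ∧ ¬ Continuous (Function.uncurry b))
    := by
  refine ⟨?_, ?_, ?_, fun q _ ↦ ?_, ?_, ?_, ?_, ?_⟩
  · exact exists_discontinuous_multiplication hn exists_mul_E_E (controlsDerivatives_E n)
      (inclDLtoE n) (continuous_inclDLtoE n) rfl (fun _ _ ↦ rfl) (exists_cutoff_E n)
  · exact exists_discontinuous_multiplication hn exists_mul_OM_OM (controlsDerivatives_OM n)
      (inclDLtoOM n) (continuous_inclDLtoOM n) rfl (fun _ _ ↦ rfl) (exists_cutoff_OM n)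
  · exact exists_discontinuous_multiplication hn exists_mul_OC_OC (controlsDerivatives_OC n)
      (stepToOC n 1 ∘ inclDLtoStep n)
      ((continuous_stepToOC n 1).comp (continuous_inclDLtoStep n)) rfl (fun _ _ ↦ rfl)
      (exists_cutoff_OC n)
  · exact exists_discontinuous_multiplication hn (exists_mul_DLDot_DL q.conjExponent)
      (controlsDerivatives_DLDot n q.conjExponent) id continuous_id rfl (fun _ _ ↦ rfl)
      (exists_cutoff_DLDot n q.conjExponent)
  · exact exists_discontinuous_multiplication hn exists_mul_S_OM (controlsDerivatives_S n)
      (inclDLtoOM n) (continuous_inclDLtoOM n) rfl (fun _ _ ↦ rfl) (exists_schwartz_cutoff n)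
  · exact exists_discontinuous_multiplication hn exists_mul_D_E (controlsDerivatives_D n)
      (inclDLtoE n) (continuous_inclDLtoE n) rfl (fun _ _ ↦ rfl) (exists_cutoff_D n)
  · obtain ⟨c, hc⟩ := exists_isConvolution n
    exact ⟨c, hc, not_continuous_of_isConvolution hn c hc⟩
  -- Here `X = 𝓔` but `Y = 𝓓`: the weaker target does not help, because the cut-off function already
  -- lies in `𝓓`.
  · exact exists_discontinuous_multiplication hn exists_mul_E_DL (controlsDerivatives_E n)
      id continuous_id rfl (fun _ _ ↦ rfl) (exists_cutoff_D n)
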